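/- Let $k$ be a field of characteristic $\neq 2$. Superspaces are finite dimensional $\mathbb Z/2$-graded $k$-vector spaces $M=M_0\oplus M_1$. For $d\ge 0$ let $\mathfrak S_d$ act on $M^{\otimes d}$ from the right by $$(x_1\otimes\cdots\otimes x_d).\sigma=\Big(\prod_{s<t,\ \sigma^{-1}s>\sigma^{-1}t}(-1)^{|x_s||x_t|}\Big)\,x_{\sigma 1}\otimes\cdots\otimes x_{\sigma d}\qquad(x_i\text{ homogeneous}).$$ Let $\mathsf\Gamma^d$ be the category whose objects are the superspaces and whose morphisms $M\to N$ form the superspace $\Gamma^d\mathrm{Hom}(M,N)=\mathrm{Hom}_{\mathfrak S_d}(M^{\otimes d},N^{\otimes d})$, and let $\mathsf{Pol}^{\mathsf I}_d$ be the category of even $k$-linear functors from $\mathsf\Gamma^d$ to superspaces, with $I^{\otimes d}\in\mathsf{Pol}^{\mathsf I}_d$ the functor $M\mapsto M^{\otimes d}$. An even isomorphism in $\mathsf{Pol}^{\mathsf I}_d$ is a natural isomorphism all of whose components are even. For a composition $\alpha$ of $d$ with Young subgroup $\mathfrak S_\alpha\subseteq\mathfrak S_d$ let $S^\alpha=S^{\alpha_1}\otimes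 S^{\alpha_2}\otimes\cdots$ be the quotient $m:I^{\otimes d}\to S^\alpha=(I^{\otimes d})_{\mathfrak S_\alpha}$, and let $\Gamma_\Pi^\alpha=\Gamma_\Pi^{\alpha_1}\otimes\Gamma_\Pi^{\alpha_2}\otimes\cdots$, where $\Gamma_\Pi^{e}=\Gamma^{e}\circ\Pi$ for even $e$ and $\Gamma_\Pi^{e}=\Pi\circ\Gamma^{e}\circ\Pi$ for odd $e$ ($\Gamma^e$ the divided power, $\Pi$ the parity change). The sign-twisting identification $(\Pi M)^{\otimes d}\cong M^{\otimes d}$ gives an even embedding $\Delta_\Pi:\Gamma_\Pi^\alpha\hookrightarrow I^{\otimes d}$ with image $\{x: x.\sigma=\mathrm{sgn}(\sigma)\,x\ \ \forall\sigma\in\mathfrak S_\alpha\}$. Through $\Delta_\Pi$, the comultiplication of the divided powers superalgebra $\Gamma^\bullet(\Pi M)$ is the inclusion $\Gamma_\Pi^{e+f}\subseteq\Gamma_\Pi^e\otimes\Gamma_\Pi^f$, and its multiplication $\Gamma_\Pi^e\otimes\Gamma_\Pi^f\to\Gamma_\Pi^{e+f}$ is $x\mapsto\sum_\sigma\mathrm{sgn}(\sigma)\,x.\sigma$,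 summed over representatives of $(\mathfrak S_e\times\mathfrak S_f)\backslash\mathfrak S_{e+f}$. Let $\mu\subset\lambda$ be partitions with $|\lambda/\mu|=d$ and conjugates $\mu'\subset\lambda'$, and write $X^{\lambda/\mu}=X^{\lambda-\mu}$ for $X=S,\Gamma_\Pi$. Number the boxes of the skew diagram of $\lambda/\mu$ by rows (left to right, top to bottom) and by columns (downwards, left to right), and let $\sigma_{\lambda'/\mu'}\in\mathfrak S_d$ send the column number of each box to its row number. Define $$\hat\theta_{\lambda'/\mu'}:\ \Gamma_\Pi^{\lambda/\mu}\xrightarrow{\ \Delta_\Pi\ }I^{\otimes d}\xrightarrow{\ .\sigma_{\lambda'/\mu'}\ }I^{\otimes d}\xrightarrow{\ m\ }S^{\lambda'/\mu'},\qquad \widehat S_{\lambda'/\mu'}=\mathrm{Im}\,\hat\theta_{\lambda'/\mu'}.$$ For $i\ge1$ and $u,v\ge0$ with $u+v<\lambda_{i+1}-\mu_i$, put $p_1=\lambda_i-\mu_i$, $p_2=\lambda_{i+1}-\mu_{i+1}$, and let $\diamondsuit_i(\lambda/\mu,u,v)$ be the composite $$\Gamma_\Pi^u\otimes\Gamma_\Pi^{p_1-u+p_2-v}\otimes\Gamma_\Pi^v\xrightarrow{1\otimes\Delta\otimes1}\Gamma_\Pi^u\otimes\Gamma_\Pi^{p_1-u}\otimes\Gamma_\Pi^{p_2-v}\otimes\Gamma_\Pi^v\xrightarrow{m\otimes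 m}\Gamma_\Pi^{p_1}\otimes\Gamma_\Pi^{p_2}$$ of comultiplication and multiplications, tensored with the identity of the other factors $\Gamma_\Pi^{\lambda_j-\mu_j}$. Let $\mathrm{Im}\,\diamondsuit_{\lambda/\mu}\subseteq\Gamma_\Pi^{\lambda/\mu}$ be the sum of the images of these maps over all $i,u,v$. Let $M$ be a superspace with $\dim M_0=m$, $\dim M_1=n$, and let $Z_1,\dots,Z_{m+n}$ be a totally ordered homogeneous basis of $M$. A tableau $t$ of shape $\lambda/\mu$ with entries in $\{1,\dots,m+n\}$ is costandard if its rows and columns are nondecreasing, equal entries $s$ in a row occur only for odd $Z_s$, and equal entries $s$ in a column occur only for even $Z_s$. For such $t$ let $Z_\Pi^{(t)}\in\Gamma_\Pi^{\lambda/\mu}(M)$ be the tensor product over the rows $i$ of the products $(\Pi Z_1)^{(a_{i1})}\cdots(\Pi Z_{m+n})^{(a_{i,m+n})}$ of divided powers, where $a_{is}$ is the number of entries $s$ in row $i$ of $t$; it is normalized so that $Z_{w_1}\otimes\cdots\otimes Z_{w_d}$, with $w$ the row reading word of $t$, has coefficient $1$ in $\Delta_\Pi(Z_\Pi^{(t)})$.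 **Theorem.** The elements $\hat\theta_{\lambda'/\mu'}(Z_\Pi^{(t)})$, for $t$ costandard of shape $\lambda/\mu$, are linearly independent and form a basis of $\widehat S_{\lambda'/\mu'}(M)$. Moreover, there is an even isomorphism $$\widehat S_{\lambda'/\mu'}\ \simeq\ \Gamma_\Pi^{\lambda/\mu}\big/\mathrm{Im}\,\diamondsuit_{\lambda/\mu}\qquad\text{in }\mathsf{Pol}^{\mathsf I}_d .$$ -/

import Mathlib

open scoped TensorProduct

universe u

noncomputable section

namespace SchurSuper

/-! ### Superspaces -/

/-- A finite dimensional vector superspace over `k`: a finite dimensional vector space `M` with a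
decomposition `M = M₀ ⊕ M₁`. -/
structure SVec (k : Type u) [Field k] where
  carrier : Type u
  [addCommGroup : AddCommGroup carrier]
  [module : Module k carrier]
  [finite : Module.Finite k carrier]
  part : ZMod 2 → Submodule k carrier
  isCompl : IsCompl (part 0) (part 1)

attribute [instance] SVec.addCommGroup SVec.module SVec.finite

instance {k : Type u} [Field k] : CoeSort (SVec k) (Type u) := ⟨SVec.carrier⟩

section Superspaces

variable {k : Type u} [Field k]

/-- `sdim M = m|n`. -/
def SVec.HasSDim (M : SVec k) (m n : ℕ) : Prop :=
  Module.finrank k (M.part 0) = m ∧ Module.finrank k (M.part 1) = n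

/-- The projection of `M = M₀ ⊕ M₁` onto `M_ε`. -/
def SVec.proj (M : SVec k) (ε : ZMod 2) : M →ₗ[k] M :=
  if ε = 0 then (M.part 0).projection (M.part 1) M.isCompl
  else (M.part 1).projection (M.part 0) M.isCompl.symm

/-- `f` is `ℤ/2`-homogeneous of degree `ε`: `f (M_δ) ⊆ N_{ε+δ}`. -/
def IsHomog {M N : SVec k} (ε : ZMod 2) (f : M →ₗ[k] N) : Prop :=
  ∀ δ : ZMod 2, ∀ x ∈ M.part δ, f x ∈ N.part (ε + δ)

theorem zmod2_cases (ε : ZMod 2) : ε = 0 ∨ ε = 1 := by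
  revert ε; decide

theorem SVec.proj_mem (M : SVec k) (ε : ZMod 2) (x : M) : M.proj ε x ∈ M.part ε := by
  rcases zmod2_cases ε with rfl | rfl
  · simp only [SVec.proj, if_true]; exact Submodule.projection_apply_mem _ _
  · simp only [SVec.proj, one_ne_zero, if_false]; exact Submodule.projection_apply_mem _ _

theorem SVec.proj_of_mem (M : SVec k) {ε : ZMod 2} {x : M} (hx : x ∈ M.part ε) :
    M.proj ε x = x := by
  rcases zmod2_cases ε with rfl | rfl
  · simp only [SVec.proj, if_true]; exact Submodule.projection_apply_of_mem_left _ hx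
  · simp only [SVec.proj, one_ne_zero, if_false]; exact Submodule.projection_apply_of_mem_left _ hx

theorem SVec.proj_of_mem_ne (M : SVec k) {ε δ : ZMod 2} {x : M} (hx : x ∈ M.part δ)
    (h : ε ≠ δ) : M.proj ε x = 0 := by
  rcases zmod2_cases ε with rfl | rfl <;> rcases zmod2_cases δ with rfl | rfl
  · exact absurd rfl h
  · simp only [SVec.proj, if_true]; exact (Submodule.projection_apply_eq_zero_iff _).2 hx
  · simp only [SVec.proj, one_ne_zero, if_false]
    exact (Submodule.projection_apply_eq_zero_iff _).2 hx
  · exact absurd rfl h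

theorem SVec.proj_add_proj (M : SVec k) (x : M) : M.proj 0 x + M.proj 1 x = x := by
  simp only [SVec.proj, if_true, one_ne_zero, if_false]
  exact Submodule.projection_add_projection_eq_self _ _

theorem SVec.sum_proj (M : SVec k) : ∑ ε : ZMod 2, M.proj ε = LinearMap.id := by
  ext x
  have h : (Finset.univ : Finset (ZMod 2)) = {0, 1} := by decide
  rw [h, Finset.sum_pair (by decide)]
  exact M.proj_add_proj x

theorem SVec.eq_zero_of_mem (M : SVec k) {x : M} (h0 : x ∈ M.part 0) (h1 : x ∈ M.part 1) :
    x = 0 := (Submodule.disjoint_def.1 M.isCompl.disjoint) x h0 h1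

theorem IsHomog.proj_comm {M N : SVec k} {f : M →ₗ[k] N} (hf : IsHomog 0 f) (ε : ZMod 2) (x : M) :
    f (M.proj ε x) = N.proj ε (f x) := by
  have h : ∀ δ : ZMod 2, f (M.proj δ x) ∈ N.part δ := fun δ => by
    simpa using hf δ _ (M.proj_mem δ x)
  conv_rhs => rw [← M.proj_add_proj x, map_add, map_add]
  rcases zmod2_cases ε with rfl | rfl
  · rw [N.proj_of_mem (h 0), N.proj_of_mem_ne (h 1) (by decide), add_zero]
  · rw [N.proj_of_mem (h 1), N.proj_of_mem_ne (h 0) (by decide), zero_add]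

/-- A subsuperspace `U = (U ∩ M₀) ⊕ (U ∩ M₁)`, as a superspace. -/
abbrev SVec.sub (M : SVec k) (U : Submodule k M)
    (hU : ∀ ε, ∀ x ∈ U, M.proj ε x ∈ U) : SVec k where
  carrier := U
  part ε := (M.part ε).comap U.subtype
  isCompl := by
    constructor
    · rw [Submodule.disjoint_def]
      intro x h0 h1
      exact Subtype.ext (M.eq_zero_of_mem h0 h1)
    · rw [codisjoint_iff, eq_top_iff]
      intro x _
      have hx : x = ⟨M.proj 0 x, hU 0 x x.2⟩ + ⟨M.proj 1 x, hU 1 x x.2⟩ :=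
        Subtype.ext (M.proj_add_proj x).symm
      rw [hx]
      exact Submodule.add_mem_sup (M.proj_mem 0 _) (M.proj_mem 1 _)

/-- The quotient of a superspace by a subsuperspace. -/
abbrev SVec.quot (M : SVec k) (U : Submodule k M)
    (hU : ∀ ε, ∀ x ∈ U, M.proj ε x ∈ U) : SVec k where
  carrier := M ⧸ U
  part ε := (M.part ε).map U.mkQ
  isCompl := by
    constructor
    · rw [Submodule.disjoint_def]
      rintro _ ⟨x, hx, rfl⟩ ⟨y, hy, hxy⟩
      have h : y - x ∈ U := by
        rw [← Submodule.Quotient.eq]; exact hxy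
      have h2 := hU 0 _ h
      rw [map_sub, M.proj_of_mem_ne hy (by decide), M.proj_of_mem hx, zero_sub] at h2
      exact (Submodule.Quotient.mk_eq_zero U).2 (by simpa using h2)
    · rw [codisjoint_iff, ← Submodule.map_sup, M.isCompl.sup_eq_top, Submodule.map_top,
        Submodule.range_mkQ]

end Superspaces

/-! ### Tensor powers and the signed action of the symmetric group -/

section TensorPowers

variable {k : Type u} [Field k] {d : ℕ}

/-- The homogeneous component of degree `ε` of `M^{⊗d}`: the span of the tensors
`x₁ ⊗ ⋯ ⊗ x_d` with homogeneous entries whose degrees add up to `ε`. -/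
def tpowPart (M : SVec k) (d : ℕ) (ε : ZMod 2) : Submodule k (⨂[k]^d (M : Type u)) :=
  Submodule.span k {t | ∃ (p : Fin d → ZMod 2) (x : Fin d → M),
    ∑ i, p i = ε ∧ (∀ i, x i ∈ M.part (p i)) ∧ t = PiTensorProduct.tprod k x}

/-- The projection of `M^{⊗d}` to `M_{p 1} ⊗ ⋯ ⊗ M_{p d}`. -/
def tpowProj (M : SVec k) (p : Fin d → ZMod 2) :
    (⨂[k]^d (M : Type u)) →ₗ[k] (⨂[k]^d (M : Type u)) :=
  PiTensorProduct.map fun i => M.proj (p i)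

theorem sum_tpowProj (M : SVec k) (t : ⨂[k]^d (M : Type u)) :
    ∑ p : Fin d → ZMod 2, tpowProj M p t = t := by
  have h : ∑ p : Fin d → ZMod 2, tpowProj (d := d) M p = LinearMap.id := by
    apply PiTensorProduct.ext
    ext x
    simp only [LinearMap.compMultilinearMap_apply, LinearMap.sum_apply, tpowProj,
      PiTensorProduct.map_tprod, LinearMap.id_apply]
    rw [← MultilinearMap.map_sum (PiTensorProduct.tprod k) (fun i (ε : ZMod 2) => M.proj ε (x i))]
    congr 1
    funext i
    have := LinearMap.congr_fun M.sum_proj (x i)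
    simpa using this
  have := LinearMap.congr_fun h t
  simpa using this

theorem tpowProj_tprod_self (M : SVec k) {p : Fin d → ZMod 2} {x : Fin d → M}
    (hx : ∀ i, x i ∈ M.part (p i)) :
    tpowProj M p (PiTensorProduct.tprod k x) = PiTensorProduct.tprod k x := by
  simp only [tpowProj, PiTensorProduct.map_tprod]
  congr 1
  funext i
  exact M.proj_of_mem (hx i)

theorem tpowProj_tprod_ne (M : SVec k) {p q : Fin d → ZMod 2} {x : Fin d → M}
    (hx : ∀ i, x i ∈ M.part (q i)) (h : p ≠ q) :
    tpowProj M p (PiTensorProduct.tprod k x) = 0 := by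
  simp only [tpowProj, PiTensorProduct.map_tprod]
  obtain ⟨i, hi⟩ := Function.ne_iff.1 h
  exact (PiTensorProduct.tprod k).map_coord_zero i (M.proj_of_mem_ne (hx i) hi)

theorem tpowProj_mem (M : SVec k) (p : Fin d → ZMod 2) (t : ⨂[k]^d (M : Type u)) :
    tpowProj M p t ∈ tpowPart M d (∑ i, p i) := by
  induction t using PiTensorProduct.induction_on with
  | smul_tprod r x =>
    rw [map_smul]
    refine Submodule.smul_mem _ _ (Submodule.subset_span ⟨p, fun i => M.proj (p i) (x i), rfl,
      fun i => M.proj_mem _ _, ?_⟩)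
    simp only [tpowProj, PiTensorProduct.map_tprod]
  | add x y hx hy => rw [map_add]; exact Submodule.add_mem _ hx hy

/-- The projection of `M^{⊗d}` to its component of degree `ε`. -/
def tpowGr (M : SVec k) (d : ℕ) (ε : ZMod 2) :
    (⨂[k]^d (M : Type u)) →ₗ[k] (⨂[k]^d (M : Type u)) :=
  ∑ p ∈ (Finset.univ : Finset (Fin d → ZMod 2)).filter (fun p => ∑ i, p i = ε), tpowProj M p

theorem tpowGr_of_mem (M : SVec k) {ε : ZMod 2} {t : ⨂[k]^d (M : Type u)}
    (ht : t ∈ tpowPart M d ε) (δ : ZMod 2) : tpowGr M d δ t = if δ = ε then t else 0 := by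
  induction ht using Submodule.span_induction with
  | mem t ht =>
    obtain ⟨p, x, hp, hx, rfl⟩ := ht
    rw [tpowGr, LinearMap.sum_apply]
    split_ifs with h
    · rw [Finset.sum_eq_single p, tpowProj_tprod_self M hx]
      · intro q _ hq
        exact tpowProj_tprod_ne M hx hq
      · intro hq
        exact absurd (by simp [hp, h]) hq
    · refine Finset.sum_eq_zero fun q hq => tpowProj_tprod_ne M hx ?_
      rintro rfl
      exact h (by rw [← (Finset.mem_filter.1 hq).2, hp])
  | zero => simp
  | add x y _ _ hx hy => rw [map_add, hx, hy]; split_ifs <;> simp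
  | smul a x _ hx => rw [map_smul, hx]; split_ifs <;> simp

/-- The tensor power `M^{⊗d}` as a superspace. -/
abbrev tpow (M : SVec k) (d : ℕ) : SVec k where
  carrier := ⨂[k]^d (M : Type u)
  finite := PiTensorProduct.finite
  part := tpowPart M d
  isCompl := by
    constructor
    · rw [Submodule.disjoint_def]
      intro t h0 h1
      have e0 := tpowGr_of_mem M h0 0
      have e1 := tpowGr_of_mem M h1 0
      rw [if_pos rfl] at e0
      rw [if_neg (by decide)] at e1
      rw [← e0, e1]
    · rw [codisjoint_iff, eq_top_iff]
      intro t _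
      rw [← sum_tpowProj M t]
      refine Submodule.sum_mem _ fun p _ => ?_
      rcases zmod2_cases (∑ i, p i) with h | h
      · exact Submodule.mem_sup_left (h ▸ tpowProj_mem M p t)
      · exact Submodule.mem_sup_right (h ▸ tpowProj_mem M p t)

/-- The sign `∏_{s < t, σ⁻¹ s > σ⁻¹ t} (-1)^{p_s p_t}`. -/
def koszulSign (p : Fin d → ZMod 2) (σ : Equiv.Perm (Fin d)) : ℤˣ :=
  ∏ t, ∏ s ∈ Finset.Iio t, if σ⁻¹ t < σ⁻¹ s then (-1) ^ (p s * p t).val else 1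

/-- The right action of `σ ∈ 𝔖_d` on `M^{⊗d}`: for homogeneous `x_i` of degree `p_i`,
`(x₁ ⊗ ⋯ ⊗ x_d).σ = koszulSign p σ • x_{σ 1} ⊗ ⋯ ⊗ x_{σ d}`. -/
def superAct (M : SVec k) (σ : Equiv.Perm (Fin d)) : tpow M d →ₗ[k] tpow M d :=
  ∑ p : Fin d → ZMod 2, ((koszulSign p σ : ℤ) : k) •
    ((PiTensorProduct.reindex k (fun _ : Fin d => (M : Type u)) σ.symm).toLinearMap ∘ₗ
      tpowProj M p)

theorem superAct_tprod (M : SVec k) (σ : Equiv.Perm (Fin d)) {p : Fin d → ZMod 2}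
    {x : Fin d → M} (hx : ∀ i, x i ∈ M.part (p i)) :
    superAct M σ (PiTensorProduct.tprod k x) =
      ((koszulSign p σ : ℤ) : k) • PiTensorProduct.tprod k (fun i => x (σ i)) := by
  rw [superAct, LinearMap.sum_apply, Finset.sum_eq_single p]
  · rw [LinearMap.smul_apply, LinearMap.comp_apply, tpowProj_tprod_self M hx]
    congr 1
    exact PiTensorProduct.reindex_tprod _ _
  · intro q _ hq
    rw [LinearMap.smul_apply, LinearMap.comp_apply, tpowProj_tprod_ne M hx hq, map_zero, smul_zero]
  · simp

theorem tpow_induction (M : SVec k) {P : tpow M d → Prop}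
    (h : ∀ (p : Fin d → ZMod 2) (x : Fin d → M), (∀ i, x i ∈ M.part (p i)) →
      P (PiTensorProduct.tprod k x))
    (hadd : ∀ x y, P x → P y → P (x + y)) (hsmul : ∀ (a : k) x, P x → P (a • x))
    (t : tpow M d) : P t := by
  have h0 : P 0 := by simpa using hsmul 0 _ (h 0 (fun _ => 0) fun i => Submodule.zero_mem _)
  have key : ∀ ε, ∀ t ∈ tpowPart M d ε, P t := by
    intro ε t ht
    induction ht using Submodule.span_induction with
    | mem t ht =>
      obtain ⟨p, x, _, hx, rfl⟩ := ht
      exact h p x hx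
    | zero => exact h0
    | add x y _ _ hx hy => exact hadd _ _ hx hy
    | smul a x _ hx => exact hsmul _ _ hx
  rw [← (tpow M d).proj_add_proj t]
  exact hadd _ _ (key 0 _ ((tpow M d).proj_mem 0 t)) (key 1 _ ((tpow M d).proj_mem 1 t))

theorem superAct_even (M : SVec k) (σ : Equiv.Perm (Fin d)) : IsHomog 0 (superAct M σ) := by
  intro ε t ht
  rw [zero_add]
  change t ∈ tpowPart M d ε at ht
  induction ht using Submodule.span_induction with
  | mem t ht =>
    obtain ⟨p, x, hp, hx, rfl⟩ := ht
    rw [superAct_tprod M σ hx]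
    exact Submodule.smul_mem _ _ (Submodule.subset_span
      ⟨fun i => p (σ i), fun i => x (σ i), by rw [← hp]; exact Equiv.sum_comp σ p,
        fun i => hx _, rfl⟩)
  | zero => rw [map_zero]; exact Submodule.zero_mem _
  | add x y _ _ hx hy => rw [map_add]; exact Submodule.add_mem _ hx hy
  | smul a x _ hx => rw [map_smul]; exact Submodule.smul_mem _ _ hx

theorem prod_pairs_comp {A : Type*} [CommMonoid A] (σ : Equiv.Perm (Fin d))
    (f : Fin d → Fin d → A) (hf : ∀ i j, f i j = f j i) :
    ∏ t, ∏ s ∈ Finset.Iio t, f (σ s) (σ t) = ∏ t, ∏ s ∈ Finset.Iio t, f s t := by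
  rw [Finset.prod_sigma', Finset.prod_sigma']
  have h1 : ∀ a b : Fin d, b < a → σ b ≠ σ a := fun a b h e => h.ne (σ.injective e)
  refine Finset.prod_bij'
    (fun x _ => ⟨max (σ x.1) (σ x.2), min (σ x.1) (σ x.2)⟩)
    (fun x _ => ⟨max (σ.symm x.1) (σ.symm x.2), min (σ.symm x.1) (σ.symm x.2)⟩) ?_ ?_ ?_ ?_ ?_
  · rintro ⟨a, b⟩ h
    have h : b < a := by simpa using h
    simpa using h1 a b h
  · rintro ⟨a, b⟩ h
    have h : b < a := by simpa using h
    simpa using h.ne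
  · rintro ⟨a, b⟩ h
    have h : b < a := by simpa using h
    rcases lt_or_ge (σ a) (σ b) with h' | h'
    · simp [max_eq_right h'.le, min_eq_left h'.le, h.le]
    · simp [max_eq_left h', min_eq_right h', h.le]
  · rintro ⟨a, b⟩ h
    have h : b < a := by simpa using h
    rcases lt_or_ge (σ.symm a) (σ.symm b) with h' | h'
    · simp [max_eq_right h'.le, min_eq_left h'.le, h.le]
    · simp [max_eq_left h', min_eq_right h', h.le]
  · rintro ⟨a, b⟩ h
    rcases lt_or_ge (σ a) (σ b) with h' | h'
    · simp only [max_eq_right h'.le, min_eq_left h'.le]; exact hf _ _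
    · simp only [max_eq_left h', min_eq_right h']

theorem koszulSign_mul (p : Fin d → ZMod 2) (σ τ : Equiv.Perm (Fin d)) :
    koszulSign p (σ * τ) = koszulSign p σ * koszulSign (fun i => p (σ i)) τ := by
  let c : Fin d → Fin d → ℤˣ := fun s t => (-1) ^ (p s * p t).val
  have hc : ∀ s t, c s t = c t s := fun s t => by simp only [c, mul_comm]
  let f : Fin d → Fin d → ℤˣ := fun s t =>
    if ((σ⁻¹ s < σ⁻¹ t) ↔ (τ⁻¹ (σ⁻¹ t) < τ⁻¹ (σ⁻¹ s))) then c s t else 1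
  have hf' : ∀ i j, i ≠ j → f i j = f j i := by
    intro i j hij
    have h1 : σ⁻¹ i ≠ σ⁻¹ j := fun e => hij (σ⁻¹.injective e)
    have h2 : τ⁻¹ (σ⁻¹ i) ≠ τ⁻¹ (σ⁻¹ j) := fun e => h1 (τ⁻¹.injective e)
    simp only [f, hc i j]
    congr 1
    rw [eq_iff_iff]
    rcases lt_or_gt_of_ne h1 with a | a <;> rcases lt_or_gt_of_ne h2 with b | b <;>
      simp only [a, b, a.not_gt, b.not_gt, iff_false, iff_true, not_true]
  have hf : ∀ i j, f i j = f j i := by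
    intro i j
    by_cases h : i = j
    · rw [h]
    · exact hf' i j h
  have e : koszulSign (fun i => p (σ i)) τ = ∏ t, ∏ s ∈ Finset.Iio t, f s t := by
    rw [← prod_pairs_comp σ f hf, koszulSign]
    refine Finset.prod_congr rfl fun t _ => Finset.prod_congr rfl fun s hs => ?_
    have hs : s < t := by simpa using hs
    simp [f, c, hs]
  rw [e, koszulSign, koszulSign, ← Finset.prod_mul_distrib]
  refine Finset.prod_congr rfl fun t _ => ?_
  rw [← Finset.prod_mul_distrib]
  refine Finset.prod_congr rfl fun s hs => ?_
  have hs : s < t := by simpa using hs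
  have h1 : σ⁻¹ s ≠ σ⁻¹ t := fun e => hs.ne (σ⁻¹.injective e)
  have h2 : τ⁻¹ (σ⁻¹ s) ≠ τ⁻¹ (σ⁻¹ t) := fun e => h1 (τ⁻¹.injective e)
  have h3 : c s t * c s t = 1 := Int.units_mul_self _
  change (if (σ * τ)⁻¹ t < (σ * τ)⁻¹ s then c s t else 1) =
    (if σ⁻¹ t < σ⁻¹ s then c s t else 1) * f s t
  simp only [mul_inv_rev, Equiv.Perm.mul_apply, f]
  rcases lt_or_gt_of_ne h1 with a | a <;> rcases lt_or_gt_of_ne h2 with b | b <;>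
    simp only [a, b, a.not_gt, b.not_gt, h3, if_true, if_false, iff_true, iff_false, not_true,
      mul_one, one_mul]

/-- `(x.σ).τ = x.(στ)`. -/
theorem superAct_superAct (M : SVec k) (σ τ : Equiv.Perm (Fin d)) (t : tpow M d) :
    superAct M τ (superAct M σ t) = superAct M (σ * τ) t := by
  induction t using tpow_induction M with
  | h p x hx =>
    rw [superAct_tprod M σ hx, map_smul, superAct_tprod M τ (fun i => hx (σ i)),
      superAct_tprod M (σ * τ) hx, koszulSign_mul, smul_smul]
    push_cast
    rfl
  | hadd x y hx hy => simp only [map_add, hx, hy]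
  | hsmul a x hx => simp only [map_smul, hx]

end TensorPowers

/-! ### Strict polynomial superfunctors of type I -/

section Functors

variable {k : Type u} [Field k] {d : ℕ}

/-- The morphisms `M → N` of the category `Γ^d_M`: the space
`Γ^d Hom(M, N) = Hom_{𝔖_d}(M^{⊗d}, N^{⊗d})`, composed as linear maps. -/
def divHom (d : ℕ) (M N : SVec k) : Submodule k (tpow M d →ₗ[k] tpow N d) where
  carrier := {φ | ∀ (σ : Equiv.Perm (Fin d)) (x : tpow M d),
    φ (superAct M σ x) = superAct N σ (φ x)}
  add_mem' := by
    intro a b ha hb σ x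
    simp only [LinearMap.add_apply, ha σ x, hb σ x, map_add]
  zero_mem' := by
    intro σ x
    simp
  smul_mem' := by
    intro c a ha σ x
    simp only [LinearMap.smul_apply, ha σ x, map_smul]

/-- The identity morphism of `M` in `Γ^d_M`. -/
def divId (d : ℕ) (M : SVec k) : divHom d M M := ⟨LinearMap.id, fun _ _ => rfl⟩

/-- Composition in `Γ^d_M`. -/
def divComp {L M N : SVec k} (ψ : divHom d M N) (φ : divHom d L M) : divHom d L N :=
  ⟨ψ.1 ∘ₗ φ.1, fun σ x => by simp only [LinearMap.comp_apply, φ.2 σ x, ψ.2 σ]⟩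

/-- An object of `Pol^I_d`: an even `k`-linear functor `Γ^d_M → svec`. -/
structure PolI (k : Type u) [Field k] (d : ℕ) where
  obj : SVec k → SVec k
  map : ∀ {M N : SVec k}, divHom d M N →ₗ[k] (obj M →ₗ[k] obj N)
  map_id : ∀ M, map (divId d M) = LinearMap.id
  map_comp : ∀ {L M N : SVec k} (ψ : divHom d M N) (φ : divHom d L M),
    map (divComp ψ φ) = map ψ ∘ₗ map φ
  map_homog : ∀ {M N : SVec k} (ε : ZMod 2) (φ : divHom d M N),
    IsHomog ε φ.1 → IsHomog ε (map φ)

/-- An even `Svec`-enriched natural transformation. -/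
structure EvenTrans (F G : PolI k d) where
  app : ∀ M : SVec k, F.obj M →ₗ[k] G.obj M
  even : ∀ M, IsHomog 0 (app M)
  natural : ∀ {M N : SVec k} (φ : divHom d M N) (x : F.obj M),
    app N (F.map φ x) = G.map φ (app M x)

/-- Composition of even natural transformations. -/
def EvenTrans.comp {F G H : PolI k d} (η : EvenTrans G H) (ζ : EvenTrans F G) :
    EvenTrans F H where
  app M := η.app M ∘ₗ ζ.app M
  even M δ x hx := by
    have h := η.even M _ _ (ζ.even M δ x hx)
    rwa [zero_add] at h
  natural φ x := by
    simp only [LinearMap.comp_apply, ζ.natural, η.natural]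

/-- There is an even isomorphism `F ≃ G` in `Pol^I_d`. -/
def EvenIso (F G : PolI k d) : Prop :=
  ∃ (η : EvenTrans F G) (ζ : EvenTrans G F),
    (∀ M x, ζ.app M (η.app M x) = x) ∧ ∀ M y, η.app M (ζ.app M y) = y

/-- A subfunctor of `F`: a family of subsuperspaces stable under all morphisms. -/
structure SubPol (F : PolI k d) where
  sub : ∀ M : SVec k, Submodule k (F.obj M)
  graded : ∀ (M : SVec k) (ε : ZMod 2), ∀ x ∈ sub M, (F.obj M).proj ε x ∈ sub M
  stable : ∀ {M N : SVec k} (φ : divHom d M N), ∀ x ∈ sub M, F.map φ x ∈ sub N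

/-- A subfunctor as an object of `Pol^I_d`. -/
abbrev SubPol.toPol {F : PolI k d} (U : SubPol F) : PolI k d where
  obj M := (F.obj M).sub (U.sub M) (U.graded M)
  map {M N} :=
    { toFun := fun φ => (F.map φ).restrict (U.stable φ)
      map_add' := fun φ ψ => by ext x; simp [LinearMap.restrict_apply]
      map_smul' := fun c φ => by ext x; simp [LinearMap.restrict_apply] }
  map_id M := by
    ext x
    simp [LinearMap.restrict_apply, F.map_id]
  map_comp ψ φ := by
    ext x
    simp [LinearMap.restrict_apply, F.map_comp]
  map_homog ε φ hφ δ x hx := F.map_homog ε φ hφ δ _ hx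

/-- The quotient of `F` by a subfunctor. -/
abbrev SubPol.quotient {F : PolI k d} (U : SubPol F) : PolI k d where
  obj M := (F.obj M).quot (U.sub M) (U.graded M)
  map {M N} :=
    { toFun := fun φ => (U.sub M).mapQ (U.sub N) (F.map φ) (U.stable φ)
      map_add' := fun φ ψ => by
        apply Submodule.linearMap_qext; ext x; simp
      map_smul' := fun c φ => by
        apply Submodule.linearMap_qext; ext x; simp }
  map_id M := by
    apply Submodule.linearMap_qext; ext x; simp [F.map_id]
  map_comp ψ φ := by
    apply Submodule.linearMap_qext; ext x; simp [F.map_comp]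
  map_homog ε φ hφ δ := by
    rintro _ ⟨x, hx, rfl⟩
    exact ⟨F.map φ x, F.map_homog ε φ hφ δ x hx, rfl⟩

/-- The inclusion of a subfunctor. -/
def SubPol.incl {F : PolI k d} (U : SubPol F) : EvenTrans U.toPol F where
  app M := (U.sub M).subtype
  even M δ x hx := by rw [zero_add]; exact hx
  natural φ x := rfl

/-- The projection to the quotient by a subfunctor. -/
def SubPol.proj {F : PolI k d} (U : SubPol F) : EvenTrans F U.quotient where
  app M := (U.sub M).mkQ
  even M δ x hx := by rw [zero_add]; exact ⟨x, hx, rfl⟩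
  natural φ x := rfl

/-- The image of an even natural transformation, as a subfunctor of its target. -/
def EvenTrans.image {F G : PolI k d} (η : EvenTrans F G) : SubPol G where
  sub M := LinearMap.range (η.app M)
  graded M ε := by
    rintro _ ⟨x, rfl⟩
    exact ⟨(F.obj M).proj ε x, (η.even M).proj_comm ε x⟩
  stable φ := by
    rintro _ ⟨x, rfl⟩
    exact ⟨F.map φ x, η.natural φ x⟩

/-- The corestriction `F → Im η` of `η : F → G`. -/
def EvenTrans.toImage {F G : PolI k d} (η : EvenTrans F G) : EvenTrans F η.image.toPol where
  app M := (η.app M).rangeRestrict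
  even M δ x hx := η.even M δ x hx
  natural φ x := Subtype.ext (η.natural φ x)

/-- The sum of a family of subfunctors. -/
def SubPol.iSup {F : PolI k d} {ι : Type} (U : ι → SubPol F) : SubPol F where
  sub M := ⨆ i, (U i).sub M
  graded M ε x hx := by
    have h : (⨆ i, (U i).sub M) ≤ (⨆ i, (U i).sub M).comap ((F.obj M).proj ε) :=
      iSup_le fun i y hy => Submodule.mem_iSup_of_mem i ((U i).graded M ε y hy)
    exact h hx
  stable {M N} φ x hx := by
    have h : (⨆ i, (U i).sub M) ≤ (⨆ i, (U i).sub N).comap (F.map φ) :=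
      iSup_le fun i y hy => Submodule.mem_iSup_of_mem i ((U i).stable φ y hy)
    exact h hx

/-- The functor `I^{⊗d}`. -/
abbrev tensorPol (k : Type u) [Field k] (d : ℕ) : PolI k d where
  obj M := tpow M d
  map := (divHom d _ _).subtype
  map_id _ := rfl
  map_comp _ _ := rfl
  map_homog _ _ h := h

/-- The action of `σ ∈ 𝔖_d` on `I^{⊗d}`. -/
def actTrans (k : Type u) [Field k] (σ : Equiv.Perm (Fin d)) :
    EvenTrans (tensorPol k d) (tensorPol k d) where
  app M := superAct M σ
  even M := superAct_even M σ
  natural φ x := (φ.2 σ x).symm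

end Functors

/-! ### Divided and symmetric powers

A composition `α` of `d` is encoded by the function `b` that sends each of the `d` places to the
block (of size `α_i`) in which it lies. -/

section Powers

variable {k : Type u} [Field k] {d : ℕ} {β γ : Type}

/-- The Young subgroup `𝔖_α ⊆ 𝔖_d` of the permutations that preserve each block of `b`. -/
def youngSubgroup (b : Fin d → β) : Subgroup (Equiv.Perm (Fin d)) where
  carrier := {σ | ∀ r, b (σ r) = b r}
  mul_mem' := by
    intro σ τ hσ hτ r
    rw [Equiv.Perm.mul_apply, hσ, hτ]
  one_mem' := fun _ => rfl
  inv_mem' := by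
    intro σ hσ r
    have h := hσ (σ⁻¹ r)
    rw [show σ (σ⁻¹ r) = r from σ.apply_symm_apply r] at h
    exact h.symm

/-- `Γ_Π^α = Γ_Π^{α_1} ⊗ Γ_Π^{α_2} ⊗ ⋯`, identified with its image under the canonical even
embedding `Δ_Π` in `I^{⊗d}`. The isomorphism `(ΠM)^{⊗d} ≅ M^{⊗d}` twists the action of `𝔖_d` by
the sign character, so the divided power `Γ^e(ΠM) = ((ΠM)^{⊗e})^{𝔖_e}` becomes the space of all
`x ∈ M^{⊗e}` with `x.σ = sgn(σ) x`, and the tensor product over the blocks becomes the space of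
all `x ∈ M^{⊗d}` with this property for the Young subgroup. The grading is that of `M^{⊗d}`; so
`Γ_Π^α` is `Γ^α ∘ Π` for even `d` and `Π ∘ Γ^α ∘ Π` for odd `d`. -/
def gammaPiSpace (M : SVec k) (b : Fin d → β) : Submodule k (tpow M d) where
  carrier := {x | ∀ σ ∈ youngSubgroup b,
    superAct M σ x = ((Equiv.Perm.sign σ : ℤ) : k) • x}
  add_mem' := by
    intro x y hx hy σ hσ
    rw [map_add, hx σ hσ, hy σ hσ, smul_add]
  zero_mem' := by
    intro σ _
    rw [map_zero, smul_zero]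
  smul_mem' := by
    intro c x hx σ hσ
    rw [map_smul, hx σ hσ, smul_comm]

/-- The family of the spaces `Γ_Π^α M`, as a subfunctor of `I^{⊗d}`. -/
abbrev gammaPiSub (k : Type u) [Field k] (b : Fin d → β) : SubPol (tensorPol k d) where
  sub M := gammaPiSpace M b
  graded M ε x hx σ hσ := by
    have h := (superAct_even M σ).proj_comm ε x
    rw [hx σ hσ, map_smul] at h
    exact h
  stable φ x hx σ hσ := by
    have h := φ.2 σ x
    rw [hx σ hσ, map_smul] at h
    exact h.symm

/-- The functor `Γ_Π^α`. -/
abbrev gammaPi (k : Type u) [Field k] (b : Fin d → β) : PolI k d := (gammaPiSub k b).toPol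

/-- The embedding `Δ_Π : Γ_Π^α → I^{⊗d}`. -/
def deltaPi (k : Type u) [Field k] (b : Fin d → β) : EvenTrans (gammaPi k b) (tensorPol k d) :=
  (gammaPiSub k b).incl

/-- The kernel of the multiplication `M^{⊗d} → S^α M = S^{α_1} M ⊗ S^{α_2} M ⊗ ⋯`. -/
def symKerSpace (M : SVec k) (b : Fin d → β) : Submodule k (tpow M d) :=
  Submodule.span k {y | ∃ σ ∈ youngSubgroup b, ∃ x : tpow M d, y = superAct M σ x - x}

/-- The family of these kernels, as a subfunctor of `I^{⊗d}`. -/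
abbrev symKer (k : Type u) [Field k] (b : Fin d → β) : SubPol (tensorPol k d) where
  sub M := symKerSpace M b
  graded M ε x hx := by
    have h : symKerSpace M b ≤ (symKerSpace M b).comap ((tpow M d).proj ε) := by
      refine Submodule.span_le.2 ?_
      rintro _ ⟨σ, hσ, x, rfl⟩
      refine Submodule.subset_span ⟨σ, hσ, (tpow M d).proj ε x, ?_⟩
      rw [(superAct_even M σ).proj_comm ε x, map_sub]
    exact h hx
  stable {M N} φ x hx := by
    have h : symKerSpace M b ≤ (symKerSpace N b).comap φ.1 := by
      refine Submodule.span_le.2 ?_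
      rintro _ ⟨σ, hσ, x, rfl⟩
      refine Submodule.subset_span ⟨σ, hσ, φ.1 x, ?_⟩
      rw [← φ.2 σ x, map_sub]
    exact h hx

/-- The functor `S^α = S^{α_1} ⊗ S^{α_2} ⊗ ⋯ = (I^{⊗d})_{𝔖_α}`. -/
abbrev symPol (k : Type u) [Field k] (b : Fin d → β) : PolI k d := (symKer k b).quotient

/-- The multiplication `m : I^{⊗d} → S^α`. -/
def symMul (k : Type u) [Field k] (b : Fin d → β) : EvenTrans (tensorPol k d) (symPol k b) :=
  (symKer k b).proj

/-- The comultiplication `Γ_Π^α → Γ_Π^{α'}` for blocks `f` that refine the blocks `b`: inside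
`I^{⊗d}` it is the inclusion. -/
def gammaComul (k : Type u) [Field k] (b : Fin d → β) (f : Fin d → γ)
    (h : youngSubgroup f ≤ youngSubgroup b) : EvenTrans (gammaPi k b) (gammaPi k f) where
  app M := Submodule.inclusion fun _ hx σ hσ => hx σ (h hσ)
  even M δ x hx := by rw [zero_add]; exact hx
  natural φ x := rfl

open Classical in
/-- The signed sum over the cosets of `H = 𝔖_f ∩ 𝔖_b` in `𝔖_b`. Representatives act through
their inverses, because the action is from the right and it is applied to elements on which `H`
acts by the sign; so the value does not depend on the representatives. -/
def cosetSum (M : SVec k) (f : Fin d → γ) (b : Fin d → β) : tpow M d →ₗ[k] tpow M d :=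
  ∑ q : youngSubgroup b ⧸ (youngSubgroup f).subgroupOf (youngSubgroup b),
    ((Equiv.Perm.sign (q.out : Equiv.Perm (Fin d)) : ℤ) : k) •
      superAct M (q.out : Equiv.Perm (Fin d))⁻¹

theorem sign_mul_self_cast (σ : Equiv.Perm (Fin d)) :
    ((Equiv.Perm.sign σ : ℤ) : k) * ((Equiv.Perm.sign σ : ℤ) : k) = 1 := by
  rw [← Int.cast_mul, ← Units.val_mul, Int.units_mul_self]; simp

theorem coset_term_eq (M : SVec k) (f : Fin d → γ) (b : Fin d → β) {x : tpow M d}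
    (hx : x ∈ gammaPiSpace M f) {g h : youngSubgroup b}
    (hgh : (QuotientGroup.mk g : youngSubgroup b ⧸
      (youngSubgroup f).subgroupOf (youngSubgroup b)) = QuotientGroup.mk h) :
    ((Equiv.Perm.sign (g : Equiv.Perm (Fin d)) : ℤ) : k) •
        superAct M (g : Equiv.Perm (Fin d))⁻¹ x =
      ((Equiv.Perm.sign (h : Equiv.Perm (Fin d)) : ℤ) : k) •
        superAct M (h : Equiv.Perm (Fin d))⁻¹ x := by
  have hm : ((g : Equiv.Perm (Fin d))⁻¹ * h) ∈ youngSubgroup f := by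
    have := QuotientGroup.eq.1 hgh
    simpa [Subgroup.mem_subgroupOf] using this
  have e : (g : Equiv.Perm (Fin d))⁻¹ = ((g : Equiv.Perm (Fin d))⁻¹ * h) *
      (h : Equiv.Perm (Fin d))⁻¹ := by group
  rw [e, ← superAct_superAct, hx _ hm, map_smul, smul_smul, Equiv.Perm.sign_mul,
    Equiv.Perm.sign_inv, Units.val_mul, Int.cast_mul, ← mul_assoc, sign_mul_self_cast, one_mul]

theorem cosetSum_mem (M : SVec k) (f : Fin d → γ) (b : Fin d → β) {x : tpow M d}
    (hx : x ∈ gammaPiSpace M f) : cosetSum M f b x ∈ gammaPiSpace M b := by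
  classical
  intro τ hτ
  let T : youngSubgroup b := ⟨τ, hτ⟩
  simp only [cosetSum, LinearMap.sum_apply, LinearMap.smul_apply, map_sum, map_smul,
    Finset.smul_sum]
  refine Fintype.sum_equiv (MulAction.toPerm T⁻¹) _ _ fun q => ?_
  have h1 : (QuotientGroup.mk (T⁻¹ * q.out) : youngSubgroup b ⧸
      (youngSubgroup f).subgroupOf (youngSubgroup b)) =
      QuotientGroup.mk ((MulAction.toPerm T⁻¹ q).out) := by
    rw [QuotientGroup.out_eq', MulAction.toPerm_apply]
    conv_rhs => rw [← QuotientGroup.out_eq' q]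
    rfl
  rw [← coset_term_eq M f b hx h1, smul_smul]
  simp only [T, Subgroup.coe_mul, Subgroup.coe_inv, mul_inv_rev, inv_inv, Equiv.Perm.sign_mul,
    Equiv.Perm.sign_inv, Units.val_mul, Int.cast_mul]
  rw [← mul_assoc, sign_mul_self_cast, one_mul, superAct_superAct]

/-- The multiplication `Γ_Π^{α'} → Γ_Π^α` of the divided powers superalgebra, for blocks `f` that
refine the blocks `b`: inside `I^{⊗d}` it is the signed sum over cosets. -/
def gammaMul (k : Type u) [Field k] (f : Fin d → γ) (b : Fin d → β) :
    EvenTrans (gammaPi k f) (gammaPi k b) where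
  app M := (cosetSum M f b).restrict fun _ hx => cosetSum_mem M f b hx
  even M δ x hx := by
    rw [zero_add]
    change cosetSum M f b x.1 ∈ tpowPart M d δ
    simp only [cosetSum, LinearMap.sum_apply, LinearMap.smul_apply]
    refine Submodule.sum_mem _ fun q _ => Submodule.smul_mem _ _ ?_
    have h := superAct_even M (q.out : Equiv.Perm (Fin d))⁻¹ δ x.1 hx
    rwa [zero_add] at h
  natural {M N} φ x := by
    apply Subtype.ext
    change cosetSum N f b (φ.1 x.1) = φ.1 (cosetSum M f b x.1)
    simp only [cosetSum, LinearMap.sum_apply, LinearMap.smul_apply, map_sum, map_smul]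
    exact Finset.sum_congr rfl fun q _ => by rw [φ.2]

end Powers

/-! ### Skew shapes, Schur superfunctors, tableaux -/

section Shapes

/-- The boxes of the skew diagram of `λ/μ` (row and column indices start at `0`). -/
def skewCells (lam mu : YoungDiagram) : Finset (ℕ × ℕ) := lam.cells \ mu.cells

/-- `|λ/μ|`. -/
abbrev skewSize (lam mu : YoungDiagram) : ℕ := (skewCells lam mu).card

/-- The numbering of a finite set of boxes from left to right in rows and from top to bottom. -/
def rowRead (s : Finset (ℕ × ℕ)) : Fin s.card ≃ s :=
  ((s.map (toLex (α := ℕ × ℕ)).toEmbedding).orderIsoOfFin (Finset.card_map _)).toEquiv.trans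
    ((toLex (α := ℕ × ℕ)).subtypeEquiv fun a => by simp).symm

/-- The numbering of a finite set of boxes down columns and from left to right. -/
def colRead (s : Finset (ℕ × ℕ)) : Fin s.card ≃ s :=
  ((s.map ((Equiv.prodComm ℕ ℕ).trans toLex).toEmbedding).orderIsoOfFin
    (Finset.card_map _)).toEquiv.trans
      (((Equiv.prodComm ℕ ℕ).trans toLex).subtypeEquiv fun a => by
        simp only [Finset.mem_map_equiv, Equiv.symm_apply_apply]).symm

variable (lam mu : YoungDiagram)

/-- The row of the `r`-th box in the row reading of `λ/μ`: the blocks of `λ - μ`. -/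
def rowBlock (r : Fin (skewSize lam mu)) : ℕ := (rowRead (skewCells lam mu) r).1.1

/-- The column of the `r`-th box in the column reading of `λ/μ`: the blocks of `λ' - μ'`. -/
def colBlock (r : Fin (skewSize lam mu)) : ℕ := (colRead (skewCells lam mu) r).1.2

/-- The permutation `σ_{λ'/μ'}`: it sends the number of a box in the column reading of `λ/μ` (the
row reading of `λ'/μ'`) to its number in the row reading of `λ/μ`. -/
def sigmaConj : Equiv.Perm (Fin (skewSize lam mu)) :=
  (colRead (skewCells lam mu)).trans (rowRead (skewCells lam mu)).symm

variable (k : Type u) [Field k]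

/-- `Γ_Π^{λ/μ}`. -/
abbrev gammaShape : PolI k (skewSize lam mu) := gammaPi k (rowBlock lam mu)

/-- `S^{λ'/μ'}`. -/
abbrev symShapeConj : PolI k (skewSize lam mu) := symPol k (colBlock lam mu)

/-- `θ̂_{λ'/μ'} : Γ_Π^{λ/μ} → I^{⊗d} → I^{⊗d} → S^{λ'/μ'}`. -/
def thetaConj : EvenTrans (gammaShape lam mu k) (symShapeConj lam mu k) :=
  (symMul k (colBlock lam mu)).comp
    ((actTrans k (sigmaConj lam mu)).comp (deltaPi k (rowBlock lam mu)))

/-- The Schur superfunctor `Ŝ_{λ'/μ'}`, the image of `θ̂_{λ'/μ'}`. -/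
abbrev schurConj : PolI k (skewSize lam mu) := (thetaConj lam mu k).image.toPol

/-- The blocks of the source
`⋯ ⊗ Γ_Π^u ⊗ Γ_Π^{p₁-u+p₂-v} ⊗ Γ_Π^v ⊗ ⋯` of `◇_i(λ/μ, u, v)`, where `p₁` and `p₂` are the
lengths of the rows `i` and `i+1` of `λ/μ`: the first `u` places of row `i`, the last `v` places
of row `i+1`, all other places of these two rows together, and every other row. -/
def diamondBlock (i u v : ℕ) (r : Fin (skewSize lam mu)) : ℕ × ℕ :=
  let c := (rowRead (skewCells lam mu) r).1
  if c.1 = i then (if c.2 < mu.rowLen i + u then (i, 0) else (i, 1))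
  else if c.1 = i + 1 then (if lam.rowLen (i + 1) ≤ c.2 + v then (i, 2) else (i, 1))
  else (c.1, 0)

/-- The blocks of the middle term
`⋯ ⊗ Γ_Π^u ⊗ Γ_Π^{p₁-u} ⊗ Γ_Π^{p₂-v} ⊗ Γ_Π^v ⊗ ⋯`. -/
def diamondFine (i u v : ℕ) (r : Fin (skewSize lam mu)) : ℕ × (ℕ × ℕ) :=
  (rowBlock lam mu r, diamondBlock lam mu i u v r)

/-- `◇_i(λ/μ, u, v)`, tensored with the identity on the other rows: the composite
`(m ⊗ m) ∘ (1 ⊗ Δ ⊗ 1)`. -/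
def diamond (i u v : ℕ) :
    EvenTrans (gammaPi k (diamondBlock lam mu i u v)) (gammaShape lam mu k) :=
  (gammaMul k (diamondFine lam mu i u v) (rowBlock lam mu)).comp
    (gammaComul k (diamondBlock lam mu i u v) (diamondFine lam mu i u v)
      fun _ hσ r => congrArg Prod.snd (hσ r))

/-- `Im ◇_{λ/μ}`: the map `◇_{λ/μ}` is the sum of the maps `◇_i(λ/μ, u, v)` with
`u + v < λ_{i+1} - μ_i`, defined on the direct sum of their sources. -/
def imDiamond : SubPol (gammaShape lam mu k) :=
  SubPol.iSup fun p : {p : ℕ × ℕ × ℕ // p.2.1 + p.2.2 + mu.rowLen p.1 < lam.rowLen (p.1 + 1)} =>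
    (diamond lam mu k p.1.1 p.1.2.1 p.1.2.2).image

/-- A tableau of shape `λ/μ` with values in `[N]`. -/
abbrev Tableau (N : ℕ) : Type := skewCells lam mu → Fin N

variable {lam mu} {N : ℕ}

/-- The rows are nondecreasing, and repeated entries of a row are odd. -/
def RowCostandard (p : Fin N → ZMod 2) (t : Tableau lam mu N) : Prop :=
  ∀ a b : skewCells lam mu, a.1.1 = b.1.1 → a.1.2 < b.1.2 →
    t a ≤ t b ∧ (t a = t b → p (t a) = 1)

/-- The columns are nondecreasing, and repeated entries of a column are even. -/
def ColCostandard (p : Fin N → ZMod 2) (t : Tableau lam mu N) : Prop :=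
  ∀ a b : skewCells lam mu, a.1.2 = b.1.2 → a.1.1 < b.1.1 →
    t a ≤ t b ∧ (t a = t b → p (t a) = 0)

/-- The costandard tableaux of shape `λ/μ`. -/
abbrev CostandardTableau (lam mu : YoungDiagram) (p : Fin N → ZMod 2) : Type :=
  {t : Tableau lam mu N // RowCostandard p t ∧ ColCostandard p t}

/-- The reading word of a tableau. -/
def word (t : Tableau lam mu N) (r : Fin (skewSize lam mu)) : Fin N :=
  t (rowRead (skewCells lam mu) r)

/-- The blocks of equal entries in the rows of a tableau. -/
def entryBlock (t : Tableau lam mu N) (r : Fin (skewSize lam mu)) : ℕ × Fin N :=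
  (rowBlock lam mu r, word t r)

theorem rowRead_lt (s : Finset (ℕ × ℕ)) {r r' : Fin s.card} (h : r < r') :
    (rowRead s r).1.1 < (rowRead s r').1.1 ∨
      (rowRead s r).1.1 = (rowRead s r').1.1 ∧ (rowRead s r).1.2 < (rowRead s r').1.2 := by
  have h1 := ((s.map (toLex (α := ℕ × ℕ)).toEmbedding).orderIsoOfFin
    (Finset.card_map _)).strictMono h
  exact Prod.Lex.lt_iff.1 (show toLex (rowRead s r).1 < toLex (rowRead s r').1 from h1)

theorem koszulSign_eq_sign {p : Fin N → ZMod 2} {t : Tableau lam mu N} (ht : RowCostandard p t)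
    {σ : Equiv.Perm (Fin (skewSize lam mu))} (hσ : σ ∈ youngSubgroup (entryBlock t)) :
    koszulSign (fun r => p (word t r)) σ = Equiv.Perm.sign σ := by
  rw [← Equiv.Perm.sign_inv, Equiv.Perm.sign_eq_prod_prod_Iio, koszulSign]
  refine Finset.prod_congr rfl fun b _ => Finset.prod_congr rfl fun a hab => ?_
  have hab : a < b := by simpa using hab
  have hne : σ⁻¹ a ≠ σ⁻¹ b := fun e => hab.ne (σ⁻¹.injective e)
  rcases lt_or_gt_of_ne hne with h | h
  · rw [if_neg h.not_gt, if_pos h]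
  · rw [if_pos h, if_neg h.not_gt]
    have ha : entryBlock t (σ⁻¹ a) = entryBlock t a := (youngSubgroup _).inv_mem hσ a
    have hb : entryBlock t (σ⁻¹ b) = entryBlock t b := (youngSubgroup _).inv_mem hσ b
    have h1 := rowRead_lt _ hab
    have h2 := rowRead_lt _ h
    simp only [entryBlock, Prod.mk.injEq, rowBlock] at ha hb
    rw [ha.1, hb.1] at h2
    have hrow : (rowRead (skewCells lam mu) a).1.1 = (rowRead (skewCells lam mu) b).1.1 := by
      omega
    have hcol : (rowRead (skewCells lam mu) a).1.2 < (rowRead (skewCells lam mu) b).1.2 := by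
      omega
    have hcol2 : (rowRead (skewCells lam mu) (σ⁻¹ b)).1.2 <
        (rowRead (skewCells lam mu) (σ⁻¹ a)).1.2 := by
      omega
    have e1 := ht _ _ hrow hcol
    have e2 := (ht _ _ (by rw [ha.1, hb.1, hrow]) hcol2).1
    have e3 : word t b ≤ word t a := by rw [← ha.2, ← hb.2]; exact e2
    have e4 : word t a = word t b := le_antisymm e1.1 e3
    have e5 : p (word t a) = 1 := e1.2 e4
    rw [← e4, e5]
    decide

variable {k}

/-- For a basis `Z` of `M` with `Z_i ∈ M_{p i}`, the tensor `Z^t = Z_{w_1} ⊗ ⋯ ⊗ Z_{w_d}`, where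
`w` is the reading word of `t`. -/
def zTensor {M : SVec k} (Z : Module.Basis (Fin N) k M) (t : Tableau lam mu N) :
    tpow M (skewSize lam mu) :=
  PiTensorProduct.tprod k fun r => Z (word t r)

theorem zTensor_mem {M : SVec k} (Z : Module.Basis (Fin N) k M) {p : Fin N → ZMod 2}
    (hZ : ∀ i, Z i ∈ M.part (p i)) {t : Tableau lam mu N} (ht : RowCostandard p t) :
    zTensor Z t ∈ gammaPiSpace M (entryBlock t) := by
  intro σ hσ
  rw [zTensor, superAct_tprod M σ (p := fun r => p (word t r)) (fun r => hZ _),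
    koszulSign_eq_sign ht hσ]
  congr 2
  funext r
  have h : word t (σ r) = word t r := congrArg Prod.snd (hσ r)
  rw [h]

/-- For a row costandard tableau `t`, the element `Z_Π^{(t)} = Z_Π^{(t^1)} ⊗ Z_Π^{(t^2)} ⊗ ⋯` of
`Γ_Π^{λ/μ} M`. The factor of the row `i` is the product, in the divided powers superalgebra, of the
divided powers `(ΠZ_s)^{(a_s)}`, where `a_s` counts the entries `s` in that row; and
`(ΠZ_s)^{(a)}` is the tensor `Z_s ⊗ ⋯ ⊗ Z_s`. -/
def zPi {M : SVec k} (Z : Module.Basis (Fin N) k M) {p : Fin N → ZMod 2}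
    (hZ : ∀ i, Z i ∈ M.part (p i)) (t : Tableau lam mu N) (ht : RowCostandard p t) :
    (gammaShape lam mu k).obj M :=
  (gammaMul k (entryBlock t) (rowBlock lam mu)).app M ⟨zTensor Z t, zTensor_mem Z hZ ht⟩

end Shapes

end SchurSuper

end

/-!
Expanding in words in the letters `Z_s`, the divided power monomials attached to the row costandard
tableaux form a basis of `Γ_Π^{λ/μ} M`. If such a tableau is not costandard, take letters `x` above
`y` in a column of the rows `i, i + 1` with `y < x`, or with `y = x` odd. The relation of `◇_i` that
fixes the letters `< x` of the row `i` and the letters `> y` of the row `i + 1` rewrites its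
monomial, modulo `Im ◇`, by monomials of larger weight `∑ row(r) w_r`. Hence the costandard elements
span modulo `Im ◇`.

The map `θ̂` kills `Im ◇`: since `u + v < λ_{i+1} - μ_i`, by the pigeonhole principle every term of
a relation is skew-symmetric in two positions of a common column, and `m` symmetrizes the columns.

For a costandard tableau `s`, summing the coefficients over the column orbit of its reading word,
with signs, gives a functional on `S^{λ'/μ'} M`. By the rearrangement inequality in each row, the
matrix of these functionals on the elements `θ̂(Z_Π^{(t)})` is triangular for the weight
`∑ col(r) w_r`, with nonzero diagonal entries. So these elements are linearly independent, and
together with the spanning statement this forces `Im ◇` to be the whole kernel of `θ̂`.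
-/

noncomputable section

namespace SchurSuper

/-! ### Koszul signs -/

section Signs

variable {d : ℕ} {β ι : Type}

theorem koszulSign_one (p : Fin d → ZMod 2) : koszulSign p 1 = 1 := by
  refine Finset.prod_eq_one fun t _ => Finset.prod_eq_one fun s hs => if_neg ?_
  simpa using (Finset.mem_Iio.1 hs).le

theorem koszulSign_conj (p : Fin d → ZMod 2) (σ τ : Equiv.Perm (Fin d))
    (h : ∀ i, p (τ (σ i)) = p (τ i)) :
    koszulSign p (τ * σ * τ⁻¹) = koszulSign (fun i => p (τ i)) σ := by
  have hτ : koszulSign p τ * koszulSign (fun i => p (τ i)) τ⁻¹ = 1 := by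
    rw [← koszulSign_mul, mul_inv_cancel, koszulSign_one]
  simp only [koszulSign_mul, Equiv.Perm.mul_apply, h]
  rw [mul_right_comm, hτ, one_mul]

theorem swap_zero_one_lt_swap_zero_one_iff {n : ℕ} {s t : Fin (n + 2)} (h : s < t) :
    Equiv.swap 0 1 t < Equiv.swap 0 1 s ↔ s = 0 ∧ t = 1 := by
  simp only [Equiv.swap_apply_def, Fin.lt_def, Fin.ext_iff, Fin.val_zero, Fin.val_one,
    apply_ite Fin.val] at h ⊢
  split_ifs <;> omega

theorem koszulSign_mul_of_comp_eq {p : Fin d → ZMod 2} {σ : Equiv.Perm (Fin d)} (h : p ∘ σ = p)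
    (τ : Equiv.Perm (Fin d)) :
    koszulSign p (σ * τ) = koszulSign p σ * koszulSign p τ :=
  (koszulSign_mul p σ τ).trans (congrArg (koszulSign p σ * koszulSign · τ) h)

theorem koszulSign_swap_zero_one {n : ℕ} (p : Fin (n + 2) → ZMod 2) :
    koszulSign p (Equiv.swap 0 1) = (-1) ^ (p 0 * p 1).val := by
  rw [koszulSign, Equiv.swap_inv, Finset.prod_eq_single 1 _ (by simp),
    Finset.prod_eq_single 0 _ (by simp)]
  · simp
  · intro s hs hs0
    exact if_neg fun h =>
      hs0 ((swap_zero_one_lt_swap_zero_one_iff (Finset.mem_Iio.1 hs)).1 h).1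
  · intro t _ ht
    exact Finset.prod_eq_one fun s hs => if_neg fun h =>
      ht ((swap_zero_one_lt_swap_zero_one_iff (Finset.mem_Iio.1 hs)).1 h).2

theorem koszulSign_swap {p : Fin d → ZMod 2} {a b : Fin d} (hab : a ≠ b) (hp : p a = p b) :
    koszulSign p (Equiv.swap a b) = (-1) ^ (p a).val := by
  obtain ⟨n, rfl⟩ : ∃ n, d = n + 2 :=
    ⟨d - 2, by have := Fin.val_ne_of_ne hab; omega⟩
  obtain ⟨τ, rfl, rfl⟩ := MulAction.is_two_pretransitive_iff.1
    (Equiv.Perm.isMultiplyPretransitive (Fin (n + 2)) 2) (zero_ne_one' (Fin (n + 2))) hab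
  rw [Equiv.Perm.smul_def, Equiv.Perm.smul_def] at hp ⊢
  rw [Equiv.swap_apply_apply,
    koszulSign_conj p _ _ (Equiv.apply_swap_eq_self (v := fun i => p (τ i)) hp),
    koszulSign_swap_zero_one, ← hp]
  rcases zmod2_cases (p (τ 0)) with h | h <;> simp [h]

theorem intUnit_cast_ne_zero {R : Type*} [Ring R] [Nontrivial R] (e : ℤˣ) :
    ((e : ℤ) : R) ≠ 0 := by
  rcases Int.units_eq_one_or e with rfl | rfl <;> simp

theorem swap_mem_youngSubgroup {b : Fin d → β} {x y : Fin d} (h : b x = b y) :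
    Equiv.swap x y ∈ youngSubgroup b :=
  Equiv.apply_swap_eq_self h

theorem closure_swap_eq_youngSubgroup (b : Fin d → β) :
    Subgroup.closure {σ | ∃ x y, x ≠ y ∧ b x = b y ∧ σ = Equiv.swap x y} = youngSubgroup b := by
  refine le_antisymm ((Subgroup.closure_le _).2 ?_) fun σ hσ => ?_
  · rintro _ ⟨x, y, -, hb, rfl⟩
    exact swap_mem_youngSubgroup hb
  · refine (mem_closure_isSwap ?_).2 ⟨Set.toFinite _, fun x => ?_⟩
    · rintro _ ⟨x, y, hxy, -, rfl⟩
      exact ⟨x, y, hxy, rfl⟩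
    · by_cases hx : σ x = x
      · rw [hx]
        exact MulAction.mem_orbit_self x
      · exact MulAction.mem_orbit_iff.2 ⟨⟨Equiv.swap x (σ x), Subgroup.subset_closure
          ⟨x, σ x, Ne.symm hx, (hσ x).symm, rfl⟩⟩, Equiv.swap_apply_left x (σ x)⟩

/-- The blocks of equal letters of the word `w` inside the blocks of `b`. -/
abbrev letterBlock (b : Fin d → β) (w : Fin d → ι) (r : Fin d) : β × ι := (b r, w r)

theorem mem_youngSubgroup_letterBlock {b : Fin d → β} {w : Fin d → ι} {σ : Equiv.Perm (Fin d)} :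
    σ ∈ youngSubgroup (letterBlock b w) ↔ σ ∈ youngSubgroup b ∧ w ∘ σ = w :=
  ⟨fun h => ⟨fun r => congrArg Prod.fst (h r), funext fun r => congrArg Prod.snd (h r)⟩,
    fun h r => Prod.ext (h.1 r) (congrFun h.2 r)⟩

/-- Only letters of parity `ε` are repeated inside the blocks of `b`. For `ε = 1` these are the
words that occur in `Γ_Π^b M`, for `ε = 0` those that do not vanish in `S^b M`. -/
def RepeatsIn (ε : ZMod 2) (p : ι → ZMod 2) (b : Fin d → β) (w : Fin d → ι) : Prop :=
  ∀ x y, x ≠ y → b x = b y → w x = w y → p (w x) = ε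

theorem koszulSign_of_repeatsIn {ε : ZMod 2} {p : ι → ZMod 2} {b : Fin d → β} {w : Fin d → ι}
    (hw : RepeatsIn ε p b w) {σ : Equiv.Perm (Fin d)}
    (hσ : σ ∈ youngSubgroup (letterBlock b w)) :
    koszulSign (p ∘ w) σ = Equiv.Perm.sign σ ^ ε.val := by
  rw [← closure_swap_eq_youngSubgroup] at hσ
  have hcomp : ∀ τ ∈ Subgroup.closure {τ | ∃ x y, x ≠ y ∧ letterBlock b w x = letterBlock b w y ∧
      τ = Equiv.swap x y}, (p ∘ w) ∘ τ = p ∘ w := fun τ hτ => by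
    rw [closure_swap_eq_youngSubgroup] at hτ
    rw [Function.comp_assoc, (mem_youngSubgroup_letterBlock.1 hτ).2]
  induction hσ using Subgroup.closure_induction with
  | mem _ h =>
    obtain ⟨x, y, hxy, hb, rfl⟩ := h
    obtain ⟨hbxy, hwxy⟩ := Prod.ext_iff.1 hb
    rw [koszulSign_swap hxy (congrArg p hwxy), Equiv.Perm.sign_swap hxy, Function.comp_apply,
      hw x y hxy hbxy hwxy]
  | one => rw [koszulSign_one, Equiv.Perm.sign_one, one_pow]
  | mul σ τ hσ _ ihσ ihτ =>
    rw [koszulSign_mul_of_comp_eq (hcomp σ hσ), ihσ, ihτ, Equiv.Perm.sign_mul, mul_pow]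
  | inv σ hσ ih =>
    have h := koszulSign_mul_of_comp_eq (hcomp σ hσ) σ⁻¹
    rw [mul_inv_cancel, koszulSign_one] at h
    rw [Equiv.Perm.sign_inv, ← ih, ← inv_eq_of_mul_eq_one_right h.symm, Int.units_inv_eq_self]

end Signs

/-! ### Coefficients of tensors at words -/

section Words

variable {k : Type u} [Field k] {d : ℕ} {β γ ι : Type} {M : SVec k}

/-- The basis of `M^{⊗d}` formed by the tensors `Z_{w_1} ⊗ ⋯ ⊗ Z_{w_d}` of the words `w` in the
letters `ι`. -/
def wordBasis (d : ℕ) (Z : Module.Basis ι k M) : Module.Basis (Fin d → ι) k (tpow M d) :=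
  Basis.piTensorProduct fun _ : Fin d => Z

theorem wordBasis_apply (Z : Module.Basis ι k M) (w : Fin d → ι) :
    wordBasis d Z w = PiTensorProduct.tprod k fun r => Z (w r) :=
  Basis.piTensorProduct_apply _ _

/-- The coefficient of the word `w` in a tensor. -/
def coeff (Z : Module.Basis ι k M) (w : Fin d → ι) : tpow M d →ₗ[k] k :=
  (wordBasis d Z).coord w

theorem coeff_wordBasis_self (Z : Module.Basis ι k M) (w : Fin d → ι) :
    coeff Z w (wordBasis d Z w) = 1 := by
  rw [coeff, Module.Basis.coord_apply, Module.Basis.repr_self, Finsupp.single_eq_same]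

theorem coeff_wordBasis_of_ne (Z : Module.Basis ι k M) {v w : Fin d → ι} (h : v ≠ w) :
    coeff Z v (wordBasis d Z w) = 0 := by
  rw [coeff, Module.Basis.coord_apply, Module.Basis.repr_self, Finsupp.single_eq_of_ne h]

variable {Z : Module.Basis ι k M} {p : ι → ZMod 2}

theorem superAct_wordBasis (hZ : ∀ i, Z i ∈ M.part (p i)) (σ : Equiv.Perm (Fin d))
    (w : Fin d → ι) :
    superAct M σ (wordBasis d Z w) =
      ((koszulSign (p ∘ w) σ : ℤ) : k) • wordBasis d Z (w ∘ σ) := by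
  rw [wordBasis_apply, wordBasis_apply, superAct_tprod M σ (p := p ∘ w) fun r => hZ _]
  rfl

theorem superAct_one (y : tpow M d) : superAct M 1 y = y := by
  induction y using tpow_induction M with
  | h p x hx => simp [superAct_tprod M 1 hx, koszulSign_one]
  | hadd x y hx hy => rw [map_add, hx, hy]
  | hsmul a x hx => rw [map_smul, hx]

theorem coeff_superAct (hZ : ∀ i, Z i ∈ M.part (p i)) (σ : Equiv.Perm (Fin d))
    (w : Fin d → ι) (y : tpow M d) :
    coeff Z (w ∘ σ) (superAct M σ y) = ((koszulSign (p ∘ w) σ : ℤ) : k) * coeff Z w y := by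
  have h : coeff Z (w ∘ σ) ∘ₗ superAct M σ = ((koszulSign (p ∘ w) σ : ℤ) : k) • coeff Z w := by
    refine (wordBasis d Z).ext fun v => ?_
    rw [LinearMap.comp_apply, superAct_wordBasis hZ, map_smul, LinearMap.smul_apply]
    by_cases hv : w = v
    · rw [hv, coeff_wordBasis_self, coeff_wordBasis_self]
    · rw [coeff_wordBasis_of_ne Z hv,
        coeff_wordBasis_of_ne Z fun h => hv (σ.surjective.right_cancellable.1 h), smul_zero,
        smul_zero]
  exact LinearMap.congr_fun h y

theorem coeff_superAct_inv (hZ : ∀ i, Z i ∈ M.part (p i)) (σ : Equiv.Perm (Fin d))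
    (w : Fin d → ι) (y : tpow M d) :
    coeff Z w (superAct M σ⁻¹ y) =
      ((koszulSign (p ∘ w ∘ σ) σ⁻¹ : ℤ) : k) * coeff Z (w ∘ σ) y := by
  have h := coeff_superAct hZ σ⁻¹ (w ∘ σ) y
  rwa [Function.comp_assoc, ← Equiv.Perm.coe_mul, mul_inv_cancel, Equiv.Perm.coe_one,
    Function.comp_id] at h

theorem coeff_comp_eq_zero_iff (hZ : ∀ i, Z i ∈ M.part (p i)) {b : Fin d → β} {y : tpow M d}
    (hy : y ∈ gammaPiSpace M b) {σ : Equiv.Perm (Fin d)} (hσ : σ ∈ youngSubgroup b)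
    (w : Fin d → ι) : coeff Z (w ∘ σ) y = 0 ↔ coeff Z w y = 0 := by
  have h := coeff_superAct hZ σ w y
  rw [hy σ hσ, map_smul, smul_eq_mul] at h
  rw [← mul_eq_zero_iff_left (intUnit_cast_ne_zero (R := k) (Equiv.Perm.sign σ)), h,
    mul_eq_zero_iff_left (intUnit_cast_ne_zero _)]

theorem coeff_eq_zero_of_not_repeatsIn (hk : ringChar k ≠ 2) (hZ : ∀ i, Z i ∈ M.part (p i))
    {b : Fin d → β} {y : tpow M d} (hy : y ∈ gammaPiSpace M b) {w : Fin d → ι}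
    (hw : ¬ RepeatsIn 1 p b w) : coeff Z w y = 0 := by
  simp only [RepeatsIn, not_forall] at hw
  obtain ⟨r, s, hrs, hb, hwrs, hp⟩ := hw
  have hp0 : p (w r) = 0 := (zmod2_cases _).resolve_right hp
  have h := coeff_superAct hZ (Equiv.swap r s) w y
  have hswap : w ∘ Equiv.swap r s = w := funext (Equiv.apply_swap_eq_self hwrs)
  rw [hy _ (swap_mem_youngSubgroup hb), hswap, map_smul, Equiv.Perm.sign_swap hrs,
    koszulSign_swap hrs (congrArg p hwrs), Function.comp_apply, hp0] at h
  have h2 : (2 : k) * coeff Z w y = 0 := by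
    simp only [Units.val_neg, Units.val_one, Int.cast_neg, Int.cast_one, neg_smul, one_smul,
      ZMod.val_zero, pow_zero, one_mul] at h
    linear_combination -h
  exact (mul_eq_zero.1 h2).resolve_left (Ring.two_ne_zero hk)

theorem exists_coeff_ne_zero_of_coeff_cosetSum_ne_zero (hZ : ∀ i, Z i ∈ M.part (p i))
    {f : Fin d → γ} {b : Fin d → β} {y : tpow M d} {w : Fin d → ι}
    (h : coeff Z w (cosetSum M f b y) ≠ 0) : ∃ σ ∈ youngSubgroup b, coeff Z (w ∘ σ) y ≠ 0 := by
  classical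
  contrapose! h
  simp only [cosetSum, LinearMap.sum_apply, LinearMap.smul_apply, map_sum, map_smul]
  refine Finset.sum_eq_zero fun q _ => ?_
  rw [coeff_superAct_inv hZ, h _ (q.out).2, mul_zero, smul_zero]

theorem coeff_cosetSum (hZ : ∀ i, Z i ∈ M.part (p i)) (f : Fin d → γ) (b : Fin d → β)
    {y : tpow M d} (hy : y ∈ gammaPiSpace M f) {w : Fin d → ι}
    (h : ∀ σ ∈ youngSubgroup b, coeff Z (w ∘ σ) y ≠ 0 → σ ∈ youngSubgroup f) :
    coeff Z w (cosetSum M f b y) = coeff Z w y := by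
  classical
  simp only [cosetSum, LinearMap.sum_apply, LinearMap.smul_apply, map_sum]
  rw [Finset.sum_eq_single (QuotientGroup.mk 1) _ (by simp)]
  · rw [coset_term_eq M f b hy (h := 1) (QuotientGroup.out_eq' _), OneMemClass.coe_one,
      Equiv.Perm.sign_one, Units.val_one, Int.cast_one, one_smul, inv_one, superAct_one]
  · intro q _ hq
    have h0 : coeff Z (w ∘ (q.out : Equiv.Perm (Fin d))) y = 0 := by
      by_contra h0
      refine hq ((QuotientGroup.out_eq' q).symm.trans (QuotientGroup.eq.2 ?_))
      simpa [Subgroup.mem_subgroupOf] using h _ (q.out).2 h0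
    rw [map_smul, coeff_superAct_inv hZ, h0, mul_zero, smul_zero]

/-- The product over the blocks of `b` of the divided powers of the letters of `w`, as a tensor. -/
def divPow (Z : Module.Basis ι k M) (b : Fin d → β) (w : Fin d → ι) : tpow M d :=
  cosetSum M (letterBlock b w) b (wordBasis d Z w)

theorem wordBasis_mem_gammaPiSpace (hZ : ∀ i, Z i ∈ M.part (p i)) {b : Fin d → β}
    {w : Fin d → ι} (hw : RepeatsIn 1 p b w) :
    wordBasis d Z w ∈ gammaPiSpace M (letterBlock b w) := by
  intro σ hσ
  rw [superAct_wordBasis hZ, koszulSign_of_repeatsIn hw hσ, ZMod.val_one, pow_one,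
    (mem_youngSubgroup_letterBlock.1 hσ).2]

theorem divPow_mem_gammaPiSpace (hZ : ∀ i, Z i ∈ M.part (p i)) {b : Fin d → β} {w : Fin d → ι}
    (hw : RepeatsIn 1 p b w) : divPow Z b w ∈ gammaPiSpace M b :=
  cosetSum_mem M _ b (wordBasis_mem_gammaPiSpace hZ hw)

theorem exists_eq_comp_of_coeff_divPow_ne_zero (hZ : ∀ i, Z i ∈ M.part (p i)) {b : Fin d → β}
    {v w : Fin d → ι} (h : coeff Z v (divPow Z b w) ≠ 0) : ∃ σ ∈ youngSubgroup b, v = w ∘ σ := by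
  obtain ⟨σ, hσ, h0⟩ := exists_coeff_ne_zero_of_coeff_cosetSum_ne_zero hZ h
  have hvw : v ∘ σ = w := not_imp_comm.1 (coeff_wordBasis_of_ne Z) h0
  refine ⟨σ⁻¹, (youngSubgroup b).inv_mem hσ, ?_⟩
  rw [← hvw, Function.comp_assoc, ← Equiv.Perm.coe_mul, mul_inv_cancel, Equiv.Perm.coe_one,
    Function.comp_id]

theorem coeff_divPow_self (hZ : ∀ i, Z i ∈ M.part (p i)) {b : Fin d → β} {w : Fin d → ι}
    (hw : RepeatsIn 1 p b w) : coeff Z w (divPow Z b w) = 1 := by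
  rw [divPow, coeff_cosetSum hZ _ b (wordBasis_mem_gammaPiSpace hZ hw), coeff_wordBasis_self]
  exact fun σ hσ h =>
    mem_youngSubgroup_letterBlock.2 ⟨hσ, not_imp_comm.1 (coeff_wordBasis_of_ne Z) h⟩

end Words

/-! ### The basis of `Γ_Π^b M` indexed by sorted words -/

section Sorted

variable {d : ℕ} {β ι : Type} [LinearOrder β] [LinearOrder ι]

/-- The letters of `w` are nondecreasing in each block of the nondecreasing function `b`. -/
def BlockSorted (b : Fin d → β) (w : Fin d → ι) : Prop :=
  Monotone fun r => toLex (b r, w r)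

theorem exists_blockSorted {b : Fin d → β} (hb : Monotone b) (w : Fin d → ι) :
    ∃ σ ∈ youngSubgroup b, BlockSorted b (w ∘ σ) := by
  let f : Fin d → β ×ₗ ι := fun r => toLex (b r, w r)
  have hf : Monotone (f ∘ Tuple.sort f) := Tuple.monotone_sort f
  have hbσ : b ∘ Tuple.sort f = b ∘ (1 : Equiv.Perm (Fin d)) :=
    Tuple.unique_monotone (fun r s h => Prod.Lex.monotone_fst _ _ (hf h)) hb
  have hfσ : (fun r => toLex (b r, (w ∘ Tuple.sort f) r)) = f ∘ Tuple.sort f :=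
    funext fun r => congrArg (fun c => toLex (c, w (Tuple.sort f r))) (congrFun hbσ r).symm
  refine ⟨Tuple.sort f, congrFun hbσ, ?_⟩
  rwa [BlockSorted, hfσ]

theorem BlockSorted.comp_eq {b : Fin d → β} {w : Fin d → ι} (hw : BlockSorted b w)
    {σ : Equiv.Perm (Fin d)} (hσ : σ ∈ youngSubgroup b) (hwσ : BlockSorted b (w ∘ σ)) :
    w ∘ σ = w := by
  have hmono : Monotone ((fun r => toLex (b r, w r)) ∘ σ) := by
    intro r s h
    simpa only [Function.comp_apply, hσ r, hσ s] using hwσ h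
  have h := Tuple.unique_monotone (τ := 1) hmono hw
  exact funext fun r => congrArg (fun x => (ofLex x).2) (congrFun h r)

variable {k : Type u} [Field k] {M : SVec k} {Z : Module.Basis ι k M} {p : ι → ZMod 2}
  {b : Fin d → β}

theorem eq_zero_of_coeff_blockSorted_eq_zero (hk : ringChar k ≠ 2)
    (hZ : ∀ i, Z i ∈ M.part (p i)) (hb : Monotone b) {y : tpow M d} (hy : y ∈ gammaPiSpace M b)
    (h : ∀ w, BlockSorted b w → RepeatsIn 1 p b w → coeff Z w y = 0) : y = 0 := by
  refine (wordBasis d Z).ext_elem fun v => ?_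
  rw [map_zero]
  obtain ⟨σ, hσ, hsorted⟩ := exists_blockSorted hb v
  refine (coeff_comp_eq_zero_iff hZ hy hσ v).1 ?_
  by_cases hrep : RepeatsIn 1 p b (v ∘ σ)
  · exact h _ hsorted hrep
  · exact coeff_eq_zero_of_not_repeatsIn hk hZ hy hrep

theorem coeff_divPow_of_ne (hZ : ∀ i, Z i ∈ M.part (p i)) {v w : Fin d → ι}
    (hv : BlockSorted b v) (hw : BlockSorted b w) (h : v ≠ w) : coeff Z v (divPow Z b w) = 0 := by
  by_contra h0
  obtain ⟨σ, hσ, rfl⟩ := exists_eq_comp_of_coeff_divPow_ne_zero hZ h0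
  exact h (hw.comp_eq hσ hv)

open Classical in
theorem eq_sum_coeff_smul_divPow [Fintype ι] (hk : ringChar k ≠ 2)
    (hZ : ∀ i, Z i ∈ M.part (p i)) (hb : Monotone b) {y : tpow M d} (hy : y ∈ gammaPiSpace M b) :
    y = ∑ w with BlockSorted b w ∧ RepeatsIn 1 p b w, coeff Z w y • divPow Z b w := by
  refine sub_eq_zero.1 (eq_zero_of_coeff_blockSorted_eq_zero hk hZ hb
    (Submodule.sub_mem _ hy (Submodule.sum_mem _ fun w hw => Submodule.smul_mem _ _
      (divPow_mem_gammaPiSpace hZ (Finset.mem_filter.1 hw).2.2))) fun v hv hrep => ?_)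
  rw [map_sub, map_sum, Finset.sum_eq_single v, map_smul, coeff_divPow_self hZ hrep, smul_eq_mul,
    mul_one, sub_self]
  · intro w hw hne
    rw [map_smul, coeff_divPow_of_ne hZ hv (Finset.mem_filter.1 hw).2.1 hne.symm, smul_zero]
  · exact fun h => absurd (Finset.mem_filter.2 ⟨Finset.mem_univ _, hv, hrep⟩) h

theorem mem_span_divPow [Finite ι] (hk : ringChar k ≠ 2) (hZ : ∀ i, Z i ∈ M.part (p i))
    (hb : Monotone b) {y : tpow M d} (hy : y ∈ gammaPiSpace M b) :
    y ∈ Submodule.span k {x | ∃ w, BlockSorted b w ∧ RepeatsIn 1 p b w ∧ coeff Z w y ≠ 0 ∧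
      x = divPow Z b w} := by
  classical
  have := Fintype.ofFinite ι
  refine Set.mem_of_eq_of_mem (eq_sum_coeff_smul_divPow hk hZ hb hy)
    (Submodule.sum_mem _ fun w hw => ?_)
  obtain ⟨hsorted, hrep⟩ := (Finset.mem_filter.1 hw).2
  by_cases h0 : coeff Z w y = 0
  · simp only [h0, zero_smul, Submodule.zero_mem]
  · exact Submodule.smul_mem _ _ (Submodule.subset_span ⟨w, hsorted, hrep, h0, rfl⟩)

end Sorted

/-! ### The relations `◇` lie in the kernel of `θ̂` -/

section Pigeonhole

theorem exists_notMem_and_notMem_of_card_lt {α γ : Type*} [Fintype α] {f g : α → γ}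
    (hf : Function.Injective f) (hg : Function.Injective g) {A B : Finset γ}
    (h : A.card + B.card < Fintype.card α) : ∃ a, f a ∉ A ∧ g a ∉ B := by
  classical
  have hcard : (A.preimage f hf.injOn ∪ B.preimage g hg.injOn).card < Fintype.card α :=
    calc (A.preimage f hf.injOn ∪ B.preimage g hg.injOn).card
        ≤ (A.preimage f hf.injOn).card + (B.preimage g hg.injOn).card := Finset.card_union_le _ _
      _ ≤ A.card + B.card := add_le_add
          (Finset.card_le_card_of_injOn f (fun _ ha => Finset.mem_preimage.1 ha) hf.injOn)
          (Finset.card_le_card_of_injOn g (fun _ ha => Finset.mem_preimage.1 ha) hg.injOn)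
      _ < Fintype.card α := h
  obtain ⟨a, -, ha⟩ := Finset.exists_mem_notMem_of_card_lt_card (t := Finset.univ) hcard
  rw [Finset.mem_union, Finset.mem_preimage, Finset.mem_preimage, not_or] at ha
  exact ⟨a, ha⟩

end Pigeonhole

section Relations

variable {k : Type u} [Field k] {d : ℕ} {β γ : Type}

theorem superAct_mem_symKerSpace (hk : ringChar k ≠ 2) {M : SVec k} {b : Fin d → β}
    {c : Fin d → γ} {y : tpow M d} (hy : y ∈ gammaPiSpace M b) (τ : Equiv.Perm (Fin d))
    {r s : Fin d} (hrs : r ≠ s) (hc : c r = c s) (hb : b (τ r) = b (τ s)) :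
    superAct M τ y ∈ symKerSpace M c := by
  have hneg : superAct M (Equiv.swap r s) (superAct M τ y) = - superAct M τ y := by
    rw [superAct_superAct, Equiv.mul_swap_eq_swap_mul, ← superAct_superAct,
      hy _ (swap_mem_youngSubgroup hb), Equiv.Perm.sign_swap fun e => hrs (τ.injective e),
      Units.val_neg, Units.val_one, Int.cast_neg, Int.cast_one, neg_one_smul, map_neg]
  have hmem : superAct M (Equiv.swap r s) (superAct M τ y) - superAct M τ y ∈ symKerSpace M c :=
    Submodule.subset_span ⟨_, swap_mem_youngSubgroup hc, _, rfl⟩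
  rw [hneg, ← neg_add', ← two_smul k, Submodule.neg_mem_iff] at hmem
  exact (Submodule.smul_mem_iff _ (Ring.two_ne_zero hk)).1 hmem

variable {lam mu : YoungDiagram}

theorem mem_skewCells {i c : ℕ} :
    (i, c) ∈ skewCells lam mu ↔ mu.rowLen i ≤ c ∧ c < lam.rowLen i := by
  rw [skewCells, Finset.mem_sdiff, YoungDiagram.mem_cells, YoungDiagram.mem_cells,
    YoungDiagram.mem_iff_lt_rowLen, YoungDiagram.mem_iff_lt_rowLen, not_lt, and_comm]

theorem row_permCongr_rowRead {τ : Equiv.Perm (Fin (skewSize lam mu))}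
    (hτ : τ ∈ youngSubgroup (rowBlock lam mu)) (a : skewCells lam mu) :
    ((rowRead (skewCells lam mu)).permCongr τ a).1.1 = a.1.1 := by
  rw [Equiv.permCongr_apply]
  exact (hτ _).trans (by rw [rowBlock, Equiv.apply_symm_apply])

theorem column_permCongr_rowRead_injective {τ : Equiv.Perm (Fin (skewSize lam mu))}
    (hτ : τ ∈ youngSubgroup (rowBlock lam mu)) {a b : skewCells lam mu} (hrow : a.1.1 = b.1.1)
    (h : ((rowRead (skewCells lam mu)).permCongr τ a).1.2 =
      ((rowRead (skewCells lam mu)).permCongr τ b).1.2) : a = b := by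
  refine ((rowRead (skewCells lam mu)).permCongr τ).injective (Subtype.ext (Prod.ext ?_ h))
  rw [row_permCongr_rowRead hτ, row_permCongr_rowRead hτ, hrow]

theorem diamondBlock_eq_middle {i u v : ℕ} {r : Fin (skewSize lam mu)}
    (h : (rowRead (skewCells lam mu) r).1.1 = i ∧
        mu.rowLen i + u ≤ (rowRead (skewCells lam mu) r).1.2 ∨
      (rowRead (skewCells lam mu) r).1.1 = i + 1 ∧
        (rowRead (skewCells lam mu) r).1.2 + v < lam.rowLen (i + 1)) :
    diamondBlock lam mu i u v r = (i, 1) := by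
  rw [diamondBlock]
  rcases h with ⟨hrow, hcol⟩ | ⟨hrow, hcol⟩
  · rw [if_pos hrow, if_neg hcol.not_gt]
  · rw [if_neg (by omega), if_pos hrow, if_neg hcol.not_ge]

theorem exists_column_diamondBlock_eq {τ : Equiv.Perm (Fin (skewSize lam mu))}
    (hτ : τ ∈ youngSubgroup (rowBlock lam mu)) {i u v : ℕ}
    (huv : u + v + mu.rowLen i < lam.rowLen (i + 1)) :
    ∃ a b : skewCells lam mu, a ≠ b ∧ a.1.2 = b.1.2 ∧
      diamondBlock lam mu i u v (τ ((rowRead (skewCells lam mu)).symm a)) =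
        diamondBlock lam mu i u v (τ ((rowRead (skewCells lam mu)).symm b)) := by
  have hlam := lam.rowLen_anti i (i + 1) (by omega)
  have hmu := mu.rowLen_anti i (i + 1) (by omega)
  let I := Finset.Ico (mu.rowLen i) (lam.rowLen (i + 1))
  let upper : I → skewCells lam mu := fun c =>
    ⟨(i, c), mem_skewCells.2 (by have := Finset.mem_Ico.1 c.2; omega)⟩
  let lower : I → skewCells lam mu := fun c =>
    ⟨(i + 1, c), mem_skewCells.2 (by have := Finset.mem_Ico.1 c.2; omega)⟩
  let moved := (rowRead (skewCells lam mu)).permCongr τ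
  have hupper : Function.Injective fun c => (moved (upper c)).1.2 := fun c c' h =>
    Subtype.ext (congrArg (fun a => a.1.2)
      (column_permCongr_rowRead_injective hτ (a := upper c) (b := upper c') rfl h))
  have hlower : Function.Injective fun c => (moved (lower c)).1.2 := fun c c' h =>
    Subtype.ext (congrArg (fun a => a.1.2)
      (column_permCongr_rowRead_injective hτ (a := lower c) (b := lower c') rfl h))
  obtain ⟨c, hcu, hcl⟩ := exists_notMem_and_notMem_of_card_lt hupper hlower
    (A := Finset.Ico (mu.rowLen i) (mu.rowLen i + u))
    (B := Finset.Ico (lam.rowLen (i + 1) - v) (lam.rowLen (i + 1)))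
    (by simp only [I, Nat.card_Ico, Fintype.card_coe]; omega)
  have hrowu : (moved (upper c)).1.1 = i := row_permCongr_rowRead hτ _
  have hrowl : (moved (lower c)).1.1 = i + 1 := row_permCongr_rowRead hτ _
  have hu : mu.rowLen (moved (upper c)).1.1 ≤ (moved (upper c)).1.2 :=
    (mem_skewCells.1 (moved (upper c)).2).1
  have hl : (moved (lower c)).1.2 < lam.rowLen (moved (lower c)).1.1 :=
    (mem_skewCells.1 (moved (lower c)).2).2
  rw [hrowu] at hu
  rw [hrowl] at hl
  rw [Finset.mem_Ico] at hcu hcl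
  have hcolu : mu.rowLen i + u ≤ (moved (upper c)).1.2 := by omega
  have hcoll : (moved (lower c)).1.2 + v < lam.rowLen (i + 1) := by omega
  refine ⟨upper c, lower c, fun h => ?_, rfl, ?_⟩
  · exact i.succ_ne_self (congrArg (fun a : skewCells lam mu => a.1.1) h).symm
  · exact (diamondBlock_eq_middle (Or.inl ⟨hrowu, hcolu⟩)).trans
      (diamondBlock_eq_middle (Or.inr ⟨hrowl, hcoll⟩)).symm

theorem sigmaConj_colRead_symm (a : skewCells lam mu) :
    sigmaConj lam mu ((colRead (skewCells lam mu)).symm a) =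
      (rowRead (skewCells lam mu)).symm a := by
  rw [sigmaConj, Equiv.trans_apply, Equiv.apply_symm_apply]

theorem thetaConj_app_eq_zero_iff {M : SVec k} (x : (gammaShape lam mu k).obj M) :
    (thetaConj lam mu k).app M x = 0 ↔
      superAct M (sigmaConj lam mu) x.1 ∈ symKerSpace M (colBlock lam mu) :=
  Submodule.Quotient.mk_eq_zero _

theorem thetaConj_diamond (hk : ringChar k ≠ 2) {i u v : ℕ}
    (huv : u + v + mu.rowLen i < lam.rowLen (i + 1)) (M : SVec k)
    (y : (gammaPi k (diamondBlock lam mu i u v)).obj M) :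
    (thetaConj lam mu k).app M ((diamond lam mu k i u v).app M y) = 0 := by
  classical
  rw [thetaConj_app_eq_zero_iff]
  change superAct M (sigmaConj lam mu)
    (cosetSum M (diamondFine lam mu i u v) (rowBlock lam mu) y.1) ∈ _
  simp only [cosetSum, LinearMap.sum_apply, LinearMap.smul_apply, map_sum, map_smul]
  refine Submodule.sum_mem _ fun q _ => Submodule.smul_mem _ _ ?_
  obtain ⟨a, b, hab, hcol, hblock⟩ := exists_column_diamondBlock_eq
    ((youngSubgroup (rowBlock lam mu)).inv_mem (q.out).2) huv
  rw [superAct_superAct]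
  refine superAct_mem_symKerSpace hk y.2 _
    (fun h => hab ((colRead (skewCells lam mu)).symm.injective h)) ?_ ?_
  · rwa [colBlock, colBlock, Equiv.apply_symm_apply, Equiv.apply_symm_apply]
  · rwa [Equiv.Perm.mul_apply, Equiv.Perm.mul_apply, sigmaConj_colRead_symm,
      sigmaConj_colRead_symm]

theorem imDiamond_le_ker_thetaConj (hk : ringChar k ≠ 2) (M : SVec k) :
    (imDiamond lam mu k).sub M ≤ LinearMap.ker ((thetaConj lam mu k).app M) := by
  refine iSup_le ?_
  rintro ⟨⟨i, u, v⟩, h⟩ _ ⟨y, rfl⟩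
  exact thetaConj_diamond hk h M y

end Relations

/-! ### Straightening -/

section Rearrangement

theorem exists_perm_comp_eq_of_card_fiber_eq {α γ : Type*} [Fintype α] [DecidableEq γ]
    {f g : α → γ} (h : ∀ c, (Finset.univ.filter fun a => f a = c).card =
      (Finset.univ.filter fun a => g a = c).card) :
    ∃ τ : Equiv.Perm α, g ∘ τ = f :=
  ⟨Equiv.ofFiberEquiv fun c => Fintype.equivOfCardEq (by
    rw [Fintype.card_subtype, Fintype.card_subtype, h c]), funext (Equiv.ofFiberEquiv_map _)⟩

theorem card_filter_comp_perm_eq {α γ : Type*} [Fintype α] [DecidableEq γ] (κ : α → γ)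
    (P : α → Prop) [DecidablePred P] (σ : Equiv.Perm α) (h : ∀ a, P (σ a) → κ (σ a) = κ a)
    (c : γ) :
    (Finset.univ.filter fun a => κ a = c ∧ P (σ a)).card =
      (Finset.univ.filter fun a => κ a = c ∧ P a).card := by
  refine Finset.card_bijective σ σ.bijective fun a => ?_
  simp only [Finset.mem_filter_univ]
  exact and_congr_left fun ha => by rw [h a ha]

theorem exists_comp_eq_comp_of_mem_youngSubgroup {d : ℕ} {γ ι : Type} {κ : Fin d → γ}
    {w : Fin d → ι} {x : ι} {σ : Equiv.Perm (Fin d)} (h : ∀ r, w (σ r) ≠ x → κ (σ r) = κ r) :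
    ∃ τ ∈ youngSubgroup κ, w ∘ σ = w ∘ τ := by
  classical
  suffices hcard : ∀ c : γ × ι, (Finset.univ.filter fun r => (κ r, w (σ r)) = c).card =
      (Finset.univ.filter fun r => (κ r, w r) = c).card by
    obtain ⟨τ, hτ⟩ := exists_perm_comp_eq_of_card_fiber_eq hcard
    exact ⟨τ, fun r => congrArg Prod.fst (congrFun hτ r),
      funext fun r => (congrArg Prod.snd (congrFun hτ r)).symm⟩
  rintro ⟨c, y⟩
  simp only [Prod.mk.injEq]
  by_cases hy : y = x
  · have hne := card_filter_comp_perm_eq κ (fun r => ¬w r = y) σ (fun r hr => h r (hy ▸ hr)) c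
    have hσ := Finset.card_filter_add_card_filter_not (s := Finset.univ.filter fun r => κ r = c)
      fun r => w (σ r) = y
    have hw := Finset.card_filter_add_card_filter_not (s := Finset.univ.filter fun r => κ r = c)
      fun r => w r = y
    simp only [Finset.filter_filter] at hσ hw
    omega
  · exact card_filter_comp_perm_eq κ (fun r => w r = y) σ
      (fun r hr => h r fun hx => hy (hr.symm.trans hx)) c

end Rearrangement

section Weight

variable {d N : ℕ} {δ : Type}

/-- The weight `∑ row(r) w_r` of a word. For the rows of a tableau straightening strictly increases
it; for the columns it orders the costandard tableaux. -/
def weight (row : Fin d → ℕ) (w : Fin d → Fin N) : ℕ := ∑ r, row r * (w r : ℕ)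

theorem weight_comp {row : Fin d → ℕ} (w : Fin d → Fin N) {σ : Equiv.Perm (Fin d)}
    (hσ : σ ∈ youngSubgroup row) : weight row (w ∘ σ) = weight row w := by
  rw [weight, weight, ← Equiv.sum_comp σ fun r => row r * (w r : ℕ)]
  exact Finset.sum_congr rfl fun r _ => by rw [hσ r, Function.comp_apply]

theorem weight_comp_sub_weight (row : Fin d → ℕ) (w : Fin d → Fin N) (x : ℤ)
    (σ : Equiv.Perm (Fin d)) :
    (weight row (w ∘ σ) : ℤ) - weight row w =
      ∑ r, ((row r : ℤ) - row (σ r)) * ((w (σ r) : ℕ) - x) := by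
  have hw : (weight row w : ℤ) = ∑ r, (row (σ r) : ℤ) * (w (σ r) : ℕ) := by
    rw [weight, ← Equiv.sum_comp σ, Nat.cast_sum]
    exact Finset.sum_congr rfl fun r _ => Nat.cast_mul _ _
  have hrow : ∑ r, (row (σ r) : ℤ) = ∑ r, (row r : ℤ) := Equiv.sum_comp σ fun r => (row r : ℤ)
  rw [hw]
  simp only [weight, Function.comp_apply, Nat.cast_sum, Nat.cast_mul, sub_mul, mul_sub,
    Finset.sum_sub_distrib, ← Finset.sum_mul, hrow]
  ring

/-- The blocks of `D` are the middle factors of a relation that straightens `w` at the letter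
`x`: a block of `D` may meet several rows, but then its letters in the upper rows are `≥ x` and
those in the lower rows are `≤ x`, and it contains all letters of a row that are equal to one of
its letters in this row. -/
structure SeparatesRows (row : Fin d → ℕ) (D : Fin d → δ) (w : Fin d → Fin N) (x : Fin N) :
    Prop where
  le_and_le : ∀ r s, D r = D s → row r < row s → x ≤ w r ∧ w s ≤ x
  block_eq : ∀ r s, row r = row s → w r = w s → D r = D s

variable {row : Fin d → ℕ} {D : Fin d → δ} {w : Fin d → Fin N} {x : Fin N}
  {σ : Equiv.Perm (Fin d)}

theorem SeparatesRows.mul_nonneg (h : SeparatesRows row D w x) (hσ : σ ∈ youngSubgroup D)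
    (r : Fin d) : 0 ≤ ((row r : ℤ) - row (σ r)) * ((w (σ r) : ℕ) - (x : ℕ)) := by
  rcases lt_trichotomy (row r) (row (σ r)) with hlt | heq | hgt
  · have hx := Fin.le_def.1 (h.le_and_le r (σ r) (hσ r).symm hlt).2
    exact mul_nonneg_of_nonpos_of_nonpos (by omega) (by omega)
  · rw [heq, sub_self, zero_mul]
  · have hx := Fin.le_def.1 (h.le_and_le (σ r) r (hσ r) hgt).1
    exact _root_.mul_nonneg (by omega) (by omega)

theorem SeparatesRows.weight_le (h : SeparatesRows row D w x) (hσ : σ ∈ youngSubgroup D) :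
    weight row w ≤ weight row (w ∘ σ) := by
  have hsum := weight_comp_sub_weight row w (x : ℕ) σ
  have hnonneg := Finset.sum_nonneg fun r (_ : r ∈ Finset.univ) => h.mul_nonneg hσ r
  omega

theorem SeparatesRows.exists_comp_eq_comp (h : SeparatesRows row D w x)
    (hσ : σ ∈ youngSubgroup D) (hweight : weight row (w ∘ σ) = weight row w) :
    ∃ τ ∈ youngSubgroup fun r => (row r, D r), w ∘ σ = w ∘ τ := by
  have hsum := weight_comp_sub_weight row w (x : ℕ) σ
  rw [hweight, sub_self, eq_comm,
    Finset.sum_eq_zero_iff_of_nonneg fun r _ => h.mul_nonneg hσ r] at hsum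
  refine exists_comp_eq_comp_of_mem_youngSubgroup (x := x) fun r hr => Prod.ext ?_ (hσ r)
  rcases mul_eq_zero.1 (hsum r (Finset.mem_univ r)) with hrow | hw
  · exact_mod_cast (sub_eq_zero.1 hrow).symm
  · exact absurd (Fin.ext (by omega)) hr

end Weight

section Straightening

variable {k : Type u} [Field k] {d N : ℕ} {δ : Type} {M : SVec k} {Z : Module.Basis (Fin N) k M}
  {p : Fin N → ZMod 2} {row : Fin d → ℕ} {D : Fin d → δ} {w : Fin d → Fin N} {x : Fin N}

theorem gammaPiSpace_mono {β γ : Type} {b : Fin d → β} {f : Fin d → γ}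
    (h : youngSubgroup f ≤ youngSubgroup b) : gammaPiSpace M b ≤ gammaPiSpace M f :=
  fun _ hx σ hσ => hx σ (h hσ)

theorem divPow_mem_gammaPiSpace_prod (hZ : ∀ i, Z i ∈ M.part (p i)) (hw : RepeatsIn 1 p D w) :
    divPow Z D w ∈ gammaPiSpace M fun r => (row r, D r) :=
  gammaPiSpace_mono (fun _ hσ r => congrArg Prod.snd (hσ r)) (divPow_mem_gammaPiSpace hZ hw)

theorem coeff_cosetSum_divPow (hZ : ∀ i, Z i ∈ M.part (p i)) (hD : SeparatesRows row D w x)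
    (hw : RepeatsIn 1 p D w) :
    coeff Z w (cosetSum M (fun r => (row r, D r)) row (divPow Z D w)) = 1 := by
  rw [coeff_cosetSum hZ _ row (divPow_mem_gammaPiSpace_prod hZ hw), coeff_divPow_self hZ hw]
  intro ρ hρ h0
  obtain ⟨σ, hσ, hwσ⟩ := exists_eq_comp_of_coeff_divPow_ne_zero hZ h0
  obtain ⟨τ, hτ, hwτ⟩ := hD.exists_comp_eq_comp hσ (by rw [← hwσ, weight_comp w hρ])
  have hrow : ∀ r, row (ρ r) = row (τ r) := fun r =>
    (hρ r).trans (congrArg Prod.fst (hτ r)).symm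
  exact fun r => Prod.ext (hρ r) ((hD.block_eq _ _ (hrow r) (congrFun (hwσ.trans hwτ) r)).trans
    (congrArg Prod.snd (hτ r)))

theorem weight_lt_of_coeff_cosetSum_ne_zero (hZ : ∀ i, Z i ∈ M.part (p i))
    (hD : SeparatesRows row D w x) {v : Fin d → Fin N}
    (h : coeff Z v (cosetSum M (fun r => (row r, D r)) row (divPow Z D w)) ≠ 0)
    (hv : ∀ σ ∈ youngSubgroup row, v ≠ w ∘ σ) : weight row w < weight row v := by
  obtain ⟨ρ, hρ, h0⟩ := exists_coeff_ne_zero_of_coeff_cosetSum_ne_zero hZ h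
  obtain ⟨σ, hσ, hvσ⟩ := exists_eq_comp_of_coeff_divPow_ne_zero hZ h0
  rw [← weight_comp v hρ, hvσ]
  refine (hD.weight_le hσ).lt_of_ne fun heq => ?_
  obtain ⟨τ, hτ, hwτ⟩ := hD.exists_comp_eq_comp hσ heq.symm
  refine hv (τ * ρ⁻¹) ((youngSubgroup row).mul_mem (fun r => congrArg Prod.fst (hτ r))
    ((youngSubgroup row).inv_mem hρ)) (ρ.surjective.right_cancellable.1 ?_)
  rw [hvσ, hwτ, Function.comp_assoc, ← Equiv.Perm.coe_mul, inv_mul_cancel_right]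

theorem divPow_sub_mem_span (hk : ringChar k ≠ 2) (hZ : ∀ i, Z i ∈ M.part (p i))
    (hrow : Monotone row) (hw : RepeatsIn 1 p row w) (hD : SeparatesRows row D w x)
    (hwD : RepeatsIn 1 p D w) :
    divPow Z row w - cosetSum M (fun r => (row r, D r)) row (divPow Z D w) ∈
      Submodule.span k {y | ∃ v, BlockSorted row v ∧ RepeatsIn 1 p row v ∧
        weight row w < weight row v ∧ y = divPow Z row v} := by
  have hmem := Submodule.sub_mem _ (divPow_mem_gammaPiSpace hZ hw)
    (cosetSum_mem M _ row (divPow_mem_gammaPiSpace_prod (row := row) hZ hwD))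
  refine Submodule.span_mono ?_ (mem_span_divPow hk hZ hrow hmem)
  rintro _ ⟨v, hsorted, hrep, hv, rfl⟩
  refine ⟨v, hsorted, hrep, ?_, rfl⟩
  have horbit : ∀ σ ∈ youngSubgroup row, v ≠ w ∘ σ := by
    rintro σ hσ rfl
    refine hv ((coeff_comp_eq_zero_iff hZ hmem hσ w).2 ?_)
    rw [map_sub, coeff_divPow_self hZ hw, coeff_cosetSum_divPow hZ hD hwD, sub_self]
  have h0 : coeff Z v (divPow Z row w) = 0 := not_imp_comm.1
    (exists_eq_comp_of_coeff_divPow_ne_zero hZ) fun ⟨σ, hσ, hvσ⟩ => horbit σ hσ hvσ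
  rw [map_sub, h0, zero_sub, neg_ne_zero] at hv
  exact weight_lt_of_coeff_cosetSum_ne_zero hZ hD hv horbit

end Straightening

section Tableaux

variable {d N : ℕ} {lam mu : YoungDiagram} {p : Fin N → ZMod 2}

theorem rowRead_symm_lt {s : Finset (ℕ × ℕ)} {a b : s} (hrow : a.1.1 = b.1.1)
    (hcol : a.1.2 < b.1.2) : (rowRead s).symm a < (rowRead s).symm b := by
  by_contra! hle
  rcases hle.lt_or_eq with hlt | heq
  · have h := rowRead_lt s hlt
    rw [Equiv.apply_symm_apply, Equiv.apply_symm_apply] at h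
    omega
  · rw [(rowRead s).symm.injective heq] at hcol
    exact lt_irrefl _ hcol

theorem rowBlock_monotone : Monotone (rowBlock lam mu) := by
  refine monotone_iff_forall_lt.2 fun r s h => ?_
  rcases rowRead_lt _ h with hlt | ⟨heq, -⟩
  exacts [hlt.le, heq.le]

/-- The tableau with a given reading word. -/
def ofWord (w : Fin (skewSize lam mu) → Fin N) : Tableau lam mu N :=
  w ∘ (rowRead (skewCells lam mu)).symm

theorem word_ofWord (w : Fin (skewSize lam mu) → Fin N) : word (ofWord w) = w :=
  funext fun r => congrArg w (Equiv.symm_apply_apply _ r)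

theorem word_rowRead_symm (t : Tableau lam mu N) (a : skewCells lam mu) :
    word t ((rowRead (skewCells lam mu)).symm a) = t a :=
  congrArg t (Equiv.apply_symm_apply _ a)

theorem rowBlock_rowRead_symm (a : skewCells lam mu) :
    rowBlock lam mu ((rowRead (skewCells lam mu)).symm a) = a.1.1 := by
  rw [rowBlock, Equiv.apply_symm_apply]

theorem RowCostandard.blockSorted {t : Tableau lam mu N} (ht : RowCostandard p t) :
    BlockSorted (rowBlock lam mu) (word t) := by
  refine monotone_iff_forall_lt.2 fun r s h => Prod.Lex.le_iff.2 ?_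
  rcases rowRead_lt _ h with hlt | ⟨heq, hlt⟩
  exacts [Or.inl hlt, Or.inr ⟨heq, (ht _ _ heq hlt).1⟩]

theorem RowCostandard.repeatsIn {t : Tableau lam mu N} (ht : RowCostandard p t) :
    RepeatsIn 1 p (rowBlock lam mu) (word t) := by
  intro r s hrs hb hw
  wlog h : r < s generalizing r s
  · rw [hw]
    exact this s r hrs.symm hb.symm hw.symm (hrs.lt_or_gt.resolve_left h)
  rcases rowRead_lt _ h with hlt | ⟨heq, hlt⟩
  exacts [absurd hb hlt.ne, (ht _ _ heq hlt).2 hw]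

theorem rowCostandard_of_blockSorted {t : Tableau lam mu N}
    (hsorted : BlockSorted (rowBlock lam mu) (word t))
    (hrep : RepeatsIn 1 p (rowBlock lam mu) (word t)) : RowCostandard p t := by
  intro a b hrow hcol
  have hlt := rowRead_symm_lt hrow hcol
  have hle := Prod.Lex.le_iff.1 (hsorted hlt.le)
  have hodd := hrep _ _ hlt.ne
  simp only [ofLex_toLex, rowBlock_rowRead_symm, word_rowRead_symm, hrow, lt_irrefl, false_or,
    true_and, forall_const] at hle hodd
  exact ⟨hle, hodd⟩

theorem RowCostandard.le {t : Tableau lam mu N} (ht : RowCostandard p t) {a b : skewCells lam mu}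
    (hrow : a.1.1 = b.1.1) (hcol : a.1.2 ≤ b.1.2) : t a ≤ t b := by
  rcases hcol.lt_or_eq with hlt | heq
  · exact (ht a b hrow hlt).1
  · rw [Subtype.ext (Prod.ext hrow heq)]

theorem colCostandard_of_adjacent {t : Tableau lam mu N}
    (h : ∀ a b : skewCells lam mu, a.1.2 = b.1.2 → b.1.1 = a.1.1 + 1 →
      t a ≤ t b ∧ (t a = t b → p (t a) = 0)) : ColCostandard p t := by
  rintro ⟨⟨i, c⟩, ha⟩ ⟨⟨j, c'⟩, hb⟩ rfl hij
  dsimp only at ha hb hij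
  induction j, hij using Nat.le_induction with
  | base => exact h _ _ rfl rfl
  | succ j hj ih =>
    have hmid : (j, c) ∈ skewCells lam mu := by
      have hmu := mu.rowLen_anti i j (by omega)
      have hlam := lam.rowLen_anti j (j + 1) (by omega)
      rw [mem_skewCells] at ha hb ⊢
      omega
    obtain ⟨hle, heven⟩ := ih hmid
    have hle' := (h ⟨_, hmid⟩ ⟨_, hb⟩ rfl rfl).1
    exact ⟨hle.trans hle', fun heq => heven (le_antisymm hle (heq ▸ hle'))⟩

theorem exists_descent_of_not_colCostandard {t : Tableau lam mu N} (h : ¬ColCostandard p t) :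
    ∃ a b : skewCells lam mu, a.1.2 = b.1.2 ∧ b.1.1 = a.1.1 + 1 ∧ t b ≤ t a ∧
      (t a = t b → p (t a) = 1) := by
  contrapose! h
  refine colCostandard_of_adjacent fun a b hcol hrow => ?_
  by_cases hle : t b ≤ t a
  · obtain ⟨heq, hp⟩ := h a b hcol hrow hle
    exact ⟨heq.le, fun _ => (zmod2_cases _).resolve_right hp⟩
  · exact ⟨(not_le.1 hle).le, fun heq => absurd heq.ge hle⟩

/-- The blocks of the relation `◇_i` that straightens `w` at the letters `y ≤ x`: they cut off the
letters `< x` of the row `i` and the letters `> y` of the row `i + 1`, and join the rest of these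
two rows. The labels agree with those of `diamondBlock`. -/
def cutBlock (row : Fin d → ℕ) (w : Fin d → Fin N) (i : ℕ) (x y : Fin N) (r : Fin d) : ℕ × ℕ :=
  if row r = i then (if w r < x then (i, 0) else (i, 1))
  else if row r = i + 1 then (if y < w r then (i, 2) else (i, 1))
  else (row r, 0)

variable {row : Fin d → ℕ} {w : Fin d → Fin N} {i : ℕ} {x y : Fin N}

theorem le_and_le_of_cutBlock_eq {r s : Fin d}
    (h : cutBlock row w i x y r = cutBlock row w i x y s) (hlt : row r < row s) :
    x ≤ w r ∧ w s ≤ y := by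
  unfold cutBlock at h
  split_ifs at h <;> simp only [Prod.mk.injEq, not_lt] at * <;> omega

theorem separatesRows_cutBlock (hyx : y ≤ x) : SeparatesRows row (cutBlock row w i x y) w x where
  le_and_le _ _ h hlt := (le_and_le_of_cutBlock_eq h hlt).imp_right fun hy => hy.trans hyx
  block_eq r s hrow hw := by rw [cutBlock, cutBlock, hrow, hw]

theorem repeatsIn_cutBlock (hrep : RepeatsIn 1 p row w) (hyx : y ≤ x) (hodd : x = y → p x = 1) :
    RepeatsIn 1 p (cutBlock row w i x y) w := by
  intro r s hrs h hw
  wlog hle : row r ≤ row s generalizing r s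
  · rw [hw]
    exact this s r hrs.symm h.symm hw.symm (le_of_not_ge hle)
  rcases hle.eq_or_lt with heq | hlt
  · exact hrep r s hrs heq hw
  · obtain ⟨hx, hy⟩ := le_and_le_of_cutBlock_eq h hlt
    have hwy : w r ≤ y := hw.trans_le hy
    rw [le_antisymm (hwy.trans hyx) hx]
    exact hodd (le_antisymm (hx.trans hwy) hyx)

theorem exists_cutoff {P : ℕ → Prop} {a b : ℕ} (hab : a ≤ b)
    (hP : ∀ m n, a ≤ m → m ≤ n → n < b → P m → P n) :
    ∃ m, a ≤ m ∧ m ≤ b ∧ ∀ n, a ≤ n → n < b → (P n ↔ m ≤ n) := by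
  classical
  have hex : ∃ m, a ≤ m ∧ (m < b → P m) := ⟨b, hab, fun h => absurd h (lt_irrefl b)⟩
  obtain ⟨ham, hm⟩ := Nat.find_spec hex
  refine ⟨Nat.find hex, ham, Nat.find_min' hex ⟨hab, fun h => absurd h (lt_irrefl b)⟩,
    fun n han hnb => ⟨fun h => Nat.find_min' hex ⟨han, fun _ => h⟩, fun h => ?_⟩⟩
  exact hP _ _ ham h hnb (hm (h.trans_lt hnb))

theorem RowCostandard.exists_cutoff {t : Tableau lam mu N} (ht : RowCostandard p t) (j : ℕ)
    (hj : mu.rowLen j ≤ lam.rowLen j) {P : Fin N → Prop} (hP : ∀ x y, x ≤ y → P x → P y) :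
    ∃ m, mu.rowLen j ≤ m ∧ m ≤ lam.rowLen j ∧
      ∀ a : skewCells lam mu, a.1.1 = j → (P (t a) ↔ m ≤ a.1.2) := by
  obtain ⟨m, hmu, hlam, hm⟩ := SchurSuper.exists_cutoff
    (P := fun c => ∀ h : (j, c) ∈ skewCells lam mu, P (t ⟨(j, c), h⟩)) hj
    fun m n hm hmn hn h hcell =>
      have hcell' := mem_skewCells.2 ⟨hm, hmn.trans_lt hn⟩
      hP _ _ (ht.le (a := ⟨_, hcell'⟩) (b := ⟨_, hcell⟩) rfl hmn) (h hcell')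
  refine ⟨m, hmu, hlam, ?_⟩
  rintro ⟨⟨_, c⟩, ha⟩ rfl
  obtain ⟨hc, hc'⟩ := mem_skewCells.1 ha
  exact ⟨fun h => (hm c hc hc').1 fun _ => h, fun h => (hm c hc hc').2 h ha⟩

theorem RowCostandard.exists_diamondBlock_eq_cutBlock {t : Tableau lam mu N}
    (ht : RowCostandard p t) {a b : skewCells lam mu} (hcol : a.1.2 = b.1.2)
    (hrow : b.1.1 = a.1.1 + 1) :
    ∃ u v : ℕ, u + v + mu.rowLen a.1.1 < lam.rowLen (a.1.1 + 1) ∧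
      diamondBlock lam mu a.1.1 u v =
        cutBlock (rowBlock lam mu) (word t) a.1.1 (t a) (t b) := by
  have ha : mu.rowLen a.1.1 ≤ a.1.2 ∧ a.1.2 < lam.rowLen a.1.1 := mem_skewCells.1 a.2
  have hb : mu.rowLen b.1.1 ≤ b.1.2 ∧ b.1.2 < lam.rowLen b.1.1 := mem_skewCells.1 b.2
  rw [hrow] at hb
  obtain ⟨m, hmu, -, hm⟩ := ht.exists_cutoff a.1.1 (by omega) (P := fun z => t a ≤ z)
    fun _ _ hle h => h.trans hle
  obtain ⟨n, -, hlam, hn⟩ := ht.exists_cutoff (a.1.1 + 1) (by omega) (P := fun z => t b < z)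
    fun _ _ hle h => h.trans_le hle
  have hma : m ≤ a.1.2 := (hm a rfl).1 le_rfl
  have hbn : b.1.2 < n := not_le.1 fun h => lt_irrefl _ ((hn b hrow).2 h)
  refine ⟨m - mu.rowLen a.1.1, lam.rowLen (a.1.1 + 1) - n, by omega, funext fun r => ?_⟩
  have hupper (hr : rowBlock lam mu r = a.1.1) : word t r < t a ↔
      (rowRead (skewCells lam mu) r).1.2 < mu.rowLen a.1.1 + (m - mu.rowLen a.1.1) := by
    rw [← not_le, word, hm _ hr]
    omega
  have hlower (hr : rowBlock lam mu r = a.1.1 + 1) : t b < word t r ↔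
      lam.rowLen (a.1.1 + 1) ≤
        (rowRead (skewCells lam mu) r).1.2 + (lam.rowLen (a.1.1 + 1) - n) := by
    rw [word, hn _ hr]
    omega
  rw [cutBlock]
  split_ifs with h1 h2 h2 h2 <;> simp_all [diamondBlock, rowBlock]

end Tableaux

/-! ### Costandard elements span modulo the relations -/

section Spanning

variable {N : ℕ} {lam mu : YoungDiagram} {p : Fin N → ZMod 2} {k : Type u} [Field k] {M : SVec k}
  {Z : Module.Basis (Fin N) k M}

theorem weight_rowBlock_le (w : Fin (skewSize lam mu) → Fin N) :
    weight (rowBlock lam mu) w ≤ ∑ r, rowBlock lam mu r * N :=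
  Finset.sum_le_sum fun r _ => Nat.mul_le_mul_left _ (w r).2.le

theorem zPi_val (hZ : ∀ i, Z i ∈ M.part (p i)) {t : Tableau lam mu N} (ht : RowCostandard p t) :
    (zPi Z hZ t ht).1 = divPow Z (rowBlock lam mu) (word t) := by
  rw [divPow, wordBasis_apply]
  rfl

theorem diamond_val {i u v : ℕ} (y : (gammaPi k (diamondBlock lam mu i u v)).obj M) :
    ((diamond lam mu k i u v).app M y).1 =
      cosetSum M (fun r => (rowBlock lam mu r, diamondBlock lam mu i u v r))
        (rowBlock lam mu) y.1 :=
  rfl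

theorem diamond_mem_imDiamond {i u v : ℕ} (h : u + v + mu.rowLen i < lam.rowLen (i + 1))
    (y : (gammaPi k (diamondBlock lam mu i u v)).obj M) :
    (diamond lam mu k i u v).app M y ∈ (imDiamond lam mu k).sub M :=
  Submodule.mem_iSup_of_mem ⟨(i, u, v), h⟩ ⟨y, rfl⟩

/-- The tensors of the elements of `Γ_Π^{λ/μ} M` that are congruent modulo `Im ◇` to a combination
of costandard elements. -/
def straightenable (Z : Module.Basis (Fin N) k M) (hZ : ∀ i, Z i ∈ M.part (p i))
    (lam mu : YoungDiagram) : Submodule k (tpow M (skewSize lam mu)) :=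
  (Submodule.span k (Set.range fun t : CostandardTableau lam mu p => zPi Z hZ t.1 t.2.1) ⊔
    (imDiamond lam mu k).sub M).map (gammaPiSpace M (rowBlock lam mu)).subtype

theorem divPow_mem_straightenable_of_costandard (hZ : ∀ i, Z i ∈ M.part (p i))
    {t : Tableau lam mu N} (hrow : RowCostandard p t) (hcol : ColCostandard p t) :
    divPow Z (rowBlock lam mu) (word t) ∈ straightenable Z hZ lam mu :=
  ⟨zPi Z hZ t hrow, Submodule.mem_sup_left (Submodule.subset_span ⟨⟨t, hrow, hcol⟩, rfl⟩),
    zPi_val hZ hrow⟩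

theorem divPow_mem_span_sup_of_not_colCostandard (hk : ringChar k ≠ 2)
    (hZ : ∀ i, Z i ∈ M.part (p i)) {t : Tableau lam mu N} (hrow : RowCostandard p t)
    (hcol : ¬ColCostandard p t) :
    divPow Z (rowBlock lam mu) (word t) ∈
      Submodule.span k {y | ∃ v, BlockSorted (rowBlock lam mu) v ∧
        RepeatsIn 1 p (rowBlock lam mu) v ∧
        weight (rowBlock lam mu) (word t) < weight (rowBlock lam mu) v ∧
        y = divPow Z (rowBlock lam mu) v} ⊔
      ((imDiamond lam mu k).sub M).map (gammaPiSpace M (rowBlock lam mu)).subtype := by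
  obtain ⟨a, b, hc, hr, hyx, hodd⟩ := exists_descent_of_not_colCostandard hcol
  obtain ⟨u, v, huv, hblock⟩ := hrow.exists_diamondBlock_eq_cutBlock hc hr
  have hsep := separatesRows_cutBlock (row := rowBlock lam mu) (w := word t) (i := a.1.1) hyx
  have hrep := repeatsIn_cutBlock (i := a.1.1) hrow.repeatsIn hyx hodd
  rw [← hblock] at hsep hrep
  have hstraight := divPow_sub_mem_span hk hZ rowBlock_monotone hrow.repeatsIn hsep hrep
  rw [← sub_add_cancel (divPow Z (rowBlock lam mu) (word t))]
  exact Submodule.add_mem_sup hstraight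
    ⟨_, diamond_mem_imDiamond huv ⟨_, divPow_mem_gammaPiSpace hZ hrep⟩, diamond_val _⟩

theorem divPow_mem_straightenable (hk : ringChar k ≠ 2) (hZ : ∀ i, Z i ∈ M.part (p i))
    {w : Fin (skewSize lam mu) → Fin N} (hw : BlockSorted (rowBlock lam mu) w)
    (hrep : RepeatsIn 1 p (rowBlock lam mu) w) :
    divPow Z (rowBlock lam mu) w ∈ straightenable Z hZ lam mu := by
  induction hn : (∑ r, rowBlock lam mu r * N) - weight (rowBlock lam mu) w
    using Nat.strong_induction_on generalizing w with
  | _ n ih =>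
    have hrow : RowCostandard p (ofWord w) :=
      rowCostandard_of_blockSorted (by rwa [word_ofWord]) (by rwa [word_ofWord])
    rw [← word_ofWord w]
    by_cases hcol : ColCostandard p (ofWord w)
    · exact divPow_mem_straightenable_of_costandard hZ hrow hcol
    · refine SetLike.le_def.1 (sup_le (Submodule.span_le.2 ?_) (Submodule.map_mono le_sup_right))
        (divPow_mem_span_sup_of_not_colCostandard hk hZ hrow hcol)
      rintro _ ⟨v, hv, hrepv, hlt, rfl⟩
      have hbound := weight_rowBlock_le v
      rw [word_ofWord] at hlt
      exact ih _ (by omega) hv hrepv rfl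

theorem span_costandard_sup_imDiamond (hk : ringChar k ≠ 2) (hZ : ∀ i, Z i ∈ M.part (p i)) :
    Submodule.span k (Set.range fun t : CostandardTableau lam mu p => zPi Z hZ t.1 t.2.1) ⊔
      (imDiamond lam mu k).sub M = ⊤ := by
  refine eq_top_iff.2 fun y _ => ?_
  have hy : y.1 ∈ straightenable Z hZ lam mu := by
    refine Submodule.span_le.2 ?_ (mem_span_divPow hk hZ rowBlock_monotone y.2)
    rintro _ ⟨w, hw, hrep, -, rfl⟩
    exact divPow_mem_straightenable hk hZ hw hrep
  obtain ⟨z, hz, hzy⟩ := hy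
  rwa [← Subtype.ext hzy]

end Spanning

/-! ### Linear independence of the costandard elements -/

section FiberwiseRearrangement

variable {α β R : Type*} [Fintype α] {b : α → β} {σ : Equiv.Perm α}

theorem sum_eq_sum_image_sum_fiber [DecidableEq β] [AddCommMonoid R] (b : α → β) (F : α → R) :
    ∑ r, F r = ∑ c ∈ Finset.univ.image b, ∑ r : {r // b r = c}, F r := by
  rw [← Finset.sum_fiberwise_of_maps_to fun r _ => Finset.mem_image_of_mem b (Finset.mem_univ r)]
  exact Finset.sum_congr rfl fun c _ => Finset.sum_subtype _ (fun r => by simp) F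

variable [Semiring R] [LinearOrder R] [IsStrictOrderedRing R] [ExistsAddOfLE R] {f g : α → R}

theorem sum_fiber_mul_comp_perm_le [DecidableEq β]
    (h : ∀ r s, b r = b s → g r < g s → f r ≤ f s) (hσ : ∀ r, b (σ r) = b r) (c : β) :
    ∑ r : {r // b r = c}, f r * g (σ r) ≤ ∑ r : {r // b r = c}, f r * g r :=
  Monovary.sum_mul_comp_perm_le_sum_mul (σ := σ.subtypePerm fun r => by rw [hσ r])
    (f := fun r : {r // b r = c} => f r) (g := fun r => g r)
    fun r s hlt => h r s (r.2.trans s.2.symm) hlt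

theorem sum_mul_comp_perm_le_of_fiber (h : ∀ r s, b r = b s → g r < g s → f r ≤ f s)
    (hσ : ∀ r, b (σ r) = b r) : ∑ r, f r * g (σ r) ≤ ∑ r, f r * g r := by
  classical
  rw [sum_eq_sum_image_sum_fiber b, sum_eq_sum_image_sum_fiber b fun r => f r * g r]
  exact Finset.sum_le_sum fun c _ => sum_fiber_mul_comp_perm_le h hσ c

theorem le_of_sum_mul_comp_perm_eq_of_fiber (h : ∀ r s, b r = b s → g r < g s → f r ≤ f s)
    (hσ : ∀ r, b (σ r) = b r) (heq : ∑ r, f r * g (σ r) = ∑ r, f r * g r) {r s : α}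
    (hb : b r = b s) (hlt : g (σ r) < g (σ s)) : f r ≤ f s := by
  classical
  rw [sum_eq_sum_image_sum_fiber b, sum_eq_sum_image_sum_fiber b fun r => f r * g r,
    Finset.sum_eq_sum_iff_of_le fun c _ => sum_fiber_mul_comp_perm_le h hσ c] at heq
  have hmono : Monovary (fun r : {r // b r = b s} => f r)
      fun r => g (σ r) :=
    (Monovary.sum_mul_comp_perm_eq_sum_mul_iff (σ := σ.subtypePerm fun r => by rw [hσ r])
      (f := fun r : {r // b r = b s} => f r) (g := fun r => g r)
      fun r s hlt => h r s (r.2.trans s.2.symm) hlt).1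
      (heq _ (Finset.mem_image_of_mem b (Finset.mem_univ s)))
  exact @hmono ⟨r, hb⟩ ⟨s, rfl⟩ hlt

end FiberwiseRearrangement

section OrbitFunctionals

theorem linearIndependent_of_triangular {R ι V γ : Type*} [Ring R] [NoZeroDivisors R]
    [AddCommGroup V] [Module R V] [LinearOrder γ] {e : ι → V} (φ : ι → V →ₗ[R] R) (wt : ι → γ)
    (hdiag : ∀ i, φ i (e i) ≠ 0) (hlt : ∀ i j, i ≠ j → φ i (e j) ≠ 0 → wt i < wt j) :
    LinearIndependent R e := by
  classical
  rw [linearIndependent_iff']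
  intro s g hg
  by_contra! hne
  obtain ⟨i, hi, hmax⟩ := (s.filter fun i => g i ≠ 0).exists_max_image wt
    (hne.imp fun _ h => Finset.mem_filter.2 h)
  rw [Finset.mem_filter] at hi
  have hφ := congrArg (φ i) hg
  simp only [map_sum, map_smul, map_zero, smul_eq_mul] at hφ
  rw [Finset.sum_eq_single_of_mem i hi.1] at hφ
  · exact mul_ne_zero hi.2 (hdiag i) hφ
  · intro j hj hji
    by_contra h0
    exact (hmax j (Finset.mem_filter.2 ⟨hj, left_ne_zero_of_mul h0⟩)).not_gt
      (hlt i j hji.symm (right_ne_zero_of_mul h0))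

variable {k : Type u} [Field k] {d : ℕ} {β ι : Type} {M : SVec k} {Z : Module.Basis ι k M}
  {p : ι → ZMod 2} {b : Fin d → β} {v : Fin d → ι}

open Classical in
/-- The signed sum of the coefficients of a tensor at the words in the orbit of `v` under the Young
subgroup of `b`: the coefficient of `Z_v` in the coinvariants of this group, if `v` repeats only
even letters in a block. Only then the choice of representatives of cosets does not matter. -/
def orbitCoeff (Z : Module.Basis ι k M) (b : Fin d → β) (v : Fin d → ι) : tpow M d →ₗ[k] k :=
  ∑ q : youngSubgroup b ⧸ (youngSubgroup (letterBlock b v)).subgroupOf (youngSubgroup b),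
    coeff Z v ∘ₗ superAct M (q.out : Equiv.Perm (Fin d))

theorem coeff_superAct_of_mem_letterBlock (hZ : ∀ i, Z i ∈ M.part (p i)) (hv : RepeatsIn 0 p b v)
    {σ : Equiv.Perm (Fin d)} (hσ : σ ∈ youngSubgroup (letterBlock b v)) (y : tpow M d) :
    coeff Z v (superAct M σ y) = coeff Z v y := by
  have h := coeff_superAct hZ σ v y
  rwa [(mem_youngSubgroup_letterBlock.1 hσ).2, koszulSign_of_repeatsIn hv hσ, ZMod.val_zero,
    pow_zero, Units.val_one, Int.cast_one, one_mul] at h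

theorem coeff_superAct_eq_of_mk_eq (hZ : ∀ i, Z i ∈ M.part (p i)) (hv : RepeatsIn 0 p b v)
    {σ τ : youngSubgroup b} (h : (QuotientGroup.mk σ : youngSubgroup b ⧸
      (youngSubgroup (letterBlock b v)).subgroupOf (youngSubgroup b)) = QuotientGroup.mk τ)
    (y : tpow M d) :
    coeff Z v (superAct M (σ : Equiv.Perm (Fin d)) y) =
      coeff Z v (superAct M (τ : Equiv.Perm (Fin d)) y) := by
  have hmem := Subgroup.mem_subgroupOf.1 (QuotientGroup.eq.1 h)
  rw [← coeff_superAct_of_mem_letterBlock hZ hv hmem (superAct M σ y), superAct_superAct,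
    Subgroup.coe_mul, Subgroup.coe_inv, mul_inv_cancel_left]

theorem orbitCoeff_superAct (hZ : ∀ i, Z i ∈ M.part (p i)) (hv : RepeatsIn 0 p b v)
    {σ : Equiv.Perm (Fin d)} (hσ : σ ∈ youngSubgroup b) (y : tpow M d) :
    orbitCoeff Z b v (superAct M σ y) = orbitCoeff Z b v y := by
  classical
  let τ : youngSubgroup b := ⟨σ, hσ⟩
  simp only [orbitCoeff, LinearMap.sum_apply, LinearMap.comp_apply]
  refine Fintype.sum_equiv (MulAction.toPerm τ) _ _ fun q => ?_
  rw [superAct_superAct]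
  refine coeff_superAct_eq_of_mk_eq hZ hv (σ := τ * q.out) (τ := (MulAction.toPerm τ q).out) ?_ y
  rw [QuotientGroup.out_eq', MulAction.toPerm_apply]
  exact congrArg (τ • ·) (QuotientGroup.out_eq' q)

theorem symKerSpace_le_ker_orbitCoeff (hZ : ∀ i, Z i ∈ M.part (p i)) (hv : RepeatsIn 0 p b v) :
    symKerSpace M b ≤ LinearMap.ker (orbitCoeff Z b v) := by
  refine Submodule.span_le.2 ?_
  rintro _ ⟨σ, hσ, y, rfl⟩
  rw [SetLike.mem_coe, LinearMap.mem_ker, map_sub, orbitCoeff_superAct hZ hv hσ, sub_self]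

theorem coeff_superAct_ne_zero_iff (hZ : ∀ i, Z i ∈ M.part (p i)) (σ : Equiv.Perm (Fin d))
    (v : Fin d → ι) (y : tpow M d) :
    coeff Z (v ∘ σ) (superAct M σ y) ≠ 0 ↔ coeff Z v y ≠ 0 := by
  rw [coeff_superAct hZ, mul_ne_zero_iff, and_iff_right (intUnit_cast_ne_zero _)]

theorem exists_coeff_ne_zero_of_orbitCoeff_ne_zero (hZ : ∀ i, Z i ∈ M.part (p i))
    {y : tpow M d} (h : orbitCoeff Z b v y ≠ 0) :
    ∃ σ ∈ youngSubgroup b, coeff Z (v ∘ σ) y ≠ 0 := by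
  classical
  contrapose! h
  simp only [orbitCoeff, LinearMap.sum_apply, LinearMap.comp_apply]
  refine Finset.sum_eq_zero fun q _ => ?_
  rw [← inv_inv (q.out : Equiv.Perm (Fin d)), coeff_superAct_inv hZ,
    h _ ((youngSubgroup b).inv_mem (q.out).2), mul_zero]

theorem orbitCoeff_eq_coeff (hZ : ∀ i, Z i ∈ M.part (p i)) (hv : RepeatsIn 0 p b v)
    {y : tpow M d} (h : ∀ σ ∈ youngSubgroup b, coeff Z (v ∘ σ) y ≠ 0 → v ∘ σ = v) :
    orbitCoeff Z b v y = coeff Z v y := by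
  classical
  simp only [orbitCoeff, LinearMap.sum_apply, LinearMap.comp_apply]
  rw [Finset.sum_eq_single (QuotientGroup.mk 1) _ (by simp)]
  · rw [coeff_superAct_eq_of_mk_eq hZ hv (τ := 1) (QuotientGroup.out_eq' _), OneMemClass.coe_one,
      superAct_one]
  · intro q _ hq
    by_contra h0
    have hinv := (youngSubgroup b).inv_mem (q.out).2
    rw [← inv_inv (q.out : Equiv.Perm (Fin d)), coeff_superAct_inv hZ] at h0
    have hmem := mem_youngSubgroup_letterBlock.2 ⟨hinv, h _ hinv (right_ne_zero_of_mul h0)⟩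
    refine hq ((QuotientGroup.out_eq' q).symm.trans (QuotientGroup.eq.2 ?_))
    rwa [mul_one, Subgroup.mem_subgroupOf, Subgroup.coe_inv]

end OrbitFunctionals

section ColumnWeight

variable {d N : ℕ} {row col : Fin d → ℕ} {w : Fin d → Fin N} {σ : Equiv.Perm (Fin d)}

theorem BlockSorted.le_of_block_eq_of_lt (hw : BlockSorted row w) {r s : Fin d}
    (hrow : row r = row s) (hlt : (w r : ℕ) < w s) : r ≤ s := by
  by_contra! h
  rcases Prod.Lex.le_iff.1 (hw h.le) with hlt' | ⟨-, hle⟩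
  exacts [hlt'.ne hrow.symm, hle.not_gt hlt]

theorem BlockSorted.weight_comp_le (hw : BlockSorted row w)
    (hcol : ∀ r s, row r = row s → r ≤ s → col r ≤ col s) (hσ : σ ∈ youngSubgroup row) :
    weight col (w ∘ σ) ≤ weight col w :=
  sum_mul_comp_perm_le_of_fiber (f := col) (g := fun r => (w r : ℕ))
    (fun r s hrow hlt => hcol r s hrow (hw.le_of_block_eq_of_lt hrow hlt)) hσ

theorem BlockSorted.comp_eq_of_weight_comp_eq (hw : BlockSorted row w) (hrow : Monotone row)
    (hcol : ∀ r s, row r = row s → r < s → col r < col s) (hσ : σ ∈ youngSubgroup row)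
    (heq : weight col (w ∘ σ) = weight col w) : w ∘ σ = w := by
  refine hw.comp_eq hσ (monotone_iff_forall_lt.2 fun r s h => Prod.Lex.le_iff.2 ?_)
  refine (hrow h.le).lt_or_eq.imp_right fun hrs => ⟨hrs, ?_⟩
  by_contra! hlt
  refine (hcol r s hrs h).not_ge (le_of_sum_mul_comp_perm_eq_of_fiber (f := col)
    (g := fun r => (w r : ℕ)) (fun r s hrow hlt => ?_) hσ heq hrs.symm hlt)
  rcases (hw.le_of_block_eq_of_lt hrow hlt).lt_or_eq with hrs' | rfl
  exacts [(hcol r s hrow hrs').le, le_rfl]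

variable {lam mu : YoungDiagram}

theorem colRead_lt (s : Finset (ℕ × ℕ)) {r r' : Fin s.card} (h : r < r') :
    (colRead s r).1.2 < (colRead s r').1.2 ∨
      (colRead s r).1.2 = (colRead s r').1.2 ∧ (colRead s r).1.1 < (colRead s r').1.1 := by
  have hlt := ((s.map ((Equiv.prodComm ℕ ℕ).trans toLex).toEmbedding).orderIsoOfFin
    (Finset.card_map _)).strictMono h
  exact Prod.Lex.lt_iff.1
    (show toLex (colRead s r).1.swap < toLex (colRead s r').1.swap from hlt)

theorem word_sigmaConj (t : Tableau lam mu N) (r : Fin (skewSize lam mu)) :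
    word t (sigmaConj lam mu r) = t (colRead (skewCells lam mu) r) := by
  rw [word, sigmaConj, Equiv.trans_apply, Equiv.apply_symm_apply]

theorem word_injective : Function.Injective (word (lam := lam) (mu := mu) (N := N)) :=
  (rowRead (skewCells lam mu)).surjective.injective_comp_right

variable {p : Fin N → ZMod 2}

theorem ColCostandard.blockSorted {t : Tableau lam mu N} (ht : ColCostandard p t) :
    BlockSorted (colBlock lam mu) (word t ∘ sigmaConj lam mu) := by
  refine monotone_iff_forall_lt.2 fun r s h => Prod.Lex.le_iff.2 ?_
  simp only [Function.comp_apply, word_sigmaConj]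
  rcases colRead_lt _ h with hlt | ⟨heq, hlt⟩
  exacts [Or.inl hlt, Or.inr ⟨heq, (ht _ _ heq hlt).1⟩]

theorem ColCostandard.repeatsIn {t : Tableau lam mu N} (ht : ColCostandard p t) :
    RepeatsIn 0 p (colBlock lam mu) (word t ∘ sigmaConj lam mu) := by
  intro r s hrs hb hw
  wlog h : r < s generalizing r s
  · rw [hw]
    exact this s r hrs.symm hb.symm hw.symm (hrs.lt_or_gt.resolve_left h)
  simp only [Function.comp_apply, word_sigmaConj] at hw ⊢
  rcases colRead_lt _ h with hlt | ⟨heq, hlt⟩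
  exacts [absurd hb hlt.ne, (ht _ _ heq hlt).2 hw]

theorem weight_colBlock_comp_sigmaConj (w : Fin (skewSize lam mu) → Fin N) :
    weight (colBlock lam mu) (w ∘ sigmaConj lam mu) =
      weight (fun r => (rowRead (skewCells lam mu) r).1.2) w := by
  rw [weight, weight, ← Equiv.sum_comp (sigmaConj lam mu)
    fun r => (rowRead (skewCells lam mu) r).1.2 * (w r : ℕ)]
  refine Finset.sum_congr rfl fun r _ => ?_
  rw [colBlock, sigmaConj, Function.comp_apply, Equiv.trans_apply, Equiv.apply_symm_apply]

theorem column_rowRead_lt {r s : Fin (skewSize lam mu)}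
    (hrow : rowBlock lam mu r = rowBlock lam mu s) (h : r < s) :
    (rowRead (skewCells lam mu) r).1.2 < (rowRead (skewCells lam mu) s).1.2 := by
  rcases rowRead_lt _ h with hlt | ⟨-, hlt⟩
  exacts [absurd hrow hlt.ne, hlt]

theorem RowCostandard.column_weight_comp_le {t : Tableau lam mu N} (ht : RowCostandard p t)
    {σ : Equiv.Perm (Fin (skewSize lam mu))} (hσ : σ ∈ youngSubgroup (rowBlock lam mu)) :
    weight (colBlock lam mu) ((word t ∘ σ) ∘ sigmaConj lam mu) ≤
      weight (colBlock lam mu) (word t ∘ sigmaConj lam mu) := by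
  rw [weight_colBlock_comp_sigmaConj, weight_colBlock_comp_sigmaConj]
  refine ht.blockSorted.weight_comp_le (fun r s hrow h => ?_) hσ
  rcases h.lt_or_eq with hlt | rfl
  exacts [(column_rowRead_lt hrow hlt).le, le_rfl]

theorem RowCostandard.word_comp_eq_of_column_weight_comp_eq {t : Tableau lam mu N}
    (ht : RowCostandard p t) {σ : Equiv.Perm (Fin (skewSize lam mu))}
    (hσ : σ ∈ youngSubgroup (rowBlock lam mu))
    (heq : weight (colBlock lam mu) ((word t ∘ σ) ∘ sigmaConj lam mu) =
      weight (colBlock lam mu) (word t ∘ sigmaConj lam mu)) : word t ∘ σ = word t := by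
  rw [weight_colBlock_comp_sigmaConj, weight_colBlock_comp_sigmaConj] at heq
  exact ht.blockSorted.comp_eq_of_weight_comp_eq rowBlock_monotone
    (fun _ _ => column_rowRead_lt) hσ heq

end ColumnWeight

section Triangularity

variable {k : Type u} [Field k] {N : ℕ} {lam mu : YoungDiagram} {M : SVec k}
  {Z : Module.Basis (Fin N) k M} {p : Fin N → ZMod 2}

theorem exists_comp_sigmaConj_eq_of_coeff_ne_zero (hZ : ∀ i, Z i ∈ M.part (p i))
    {u w : Fin (skewSize lam mu) → Fin N}
    (h : coeff Z u (superAct M (sigmaConj lam mu) (divPow Z (rowBlock lam mu) w)) ≠ 0) :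
    ∃ σ ∈ youngSubgroup (rowBlock lam mu), u = (w ∘ σ) ∘ sigmaConj lam mu := by
  have hu : u = (u ∘ ⇑(sigmaConj lam mu)⁻¹) ∘ sigmaConj lam mu := by
    rw [Function.comp_assoc, ← Equiv.Perm.coe_mul, inv_mul_cancel, Equiv.Perm.coe_one,
      Function.comp_id]
  rw [hu, coeff_superAct_ne_zero_iff hZ] at h
  obtain ⟨σ, hσ, hσu⟩ := exists_eq_comp_of_coeff_divPow_ne_zero hZ h
  exact ⟨σ, hσ, by rw [← hσu, ← hu]⟩

variable {s t : Tableau lam mu N} {τ : Equiv.Perm (Fin (skewSize lam mu))}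

theorem column_weight_le_of_coeff_ne_zero (hZ : ∀ i, Z i ∈ M.part (p i)) (ht : RowCostandard p t)
    (hτ : τ ∈ youngSubgroup (colBlock lam mu))
    (h : coeff Z ((word s ∘ sigmaConj lam mu) ∘ τ)
      (superAct M (sigmaConj lam mu) (divPow Z (rowBlock lam mu) (word t))) ≠ 0) :
    weight (colBlock lam mu) (word s ∘ sigmaConj lam mu) ≤
      weight (colBlock lam mu) (word t ∘ sigmaConj lam mu) := by
  obtain ⟨σ, hσ, heq⟩ := exists_comp_sigmaConj_eq_of_coeff_ne_zero hZ h
  rw [← weight_comp _ hτ, heq]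
  exact ht.column_weight_comp_le hσ

theorem word_comp_eq_of_coeff_ne_zero (hZ : ∀ i, Z i ∈ M.part (p i)) (ht : RowCostandard p t)
    (hτ : τ ∈ youngSubgroup (colBlock lam mu))
    (h : coeff Z ((word s ∘ sigmaConj lam mu) ∘ τ)
      (superAct M (sigmaConj lam mu) (divPow Z (rowBlock lam mu) (word t))) ≠ 0)
    (hweight : weight (colBlock lam mu) (word s ∘ sigmaConj lam mu) =
      weight (colBlock lam mu) (word t ∘ sigmaConj lam mu)) :
    (word s ∘ sigmaConj lam mu) ∘ τ = word t ∘ sigmaConj lam mu := by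
  obtain ⟨σ, hσ, heq⟩ := exists_comp_sigmaConj_eq_of_coeff_ne_zero hZ h
  rw [← weight_comp _ hτ, heq] at hweight
  rw [heq, ht.word_comp_eq_of_column_weight_comp_eq hσ hweight]

theorem ColCostandard.eq_of_word_comp_eq (hs : ColCostandard p s) (ht : ColCostandard p t)
    (hτ : τ ∈ youngSubgroup (colBlock lam mu))
    (h : (word s ∘ sigmaConj lam mu) ∘ τ = word t ∘ sigmaConj lam mu) : s = t := by
  have hsorted := hs.blockSorted.comp_eq hτ (h.symm ▸ ht.blockSorted)
  exact word_injective ((sigmaConj lam mu).surjective.right_cancellable.1 (hsorted.symm.trans h))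

/-- The linear functional on `S^{λ'/μ'} M` given by the orbit of the column reading word of the
costandard tableau `t`. -/
def tableauCoeff (hZ : ∀ i, Z i ∈ M.part (p i)) (t : CostandardTableau lam mu p) :
    (symShapeConj lam mu k).obj M →ₗ[k] k :=
  (symKerSpace M (colBlock lam mu)).liftQ
    (orbitCoeff Z (colBlock lam mu) (word t.1 ∘ sigmaConj lam mu))
    (symKerSpace_le_ker_orbitCoeff hZ t.2.2.repeatsIn)

theorem tableauCoeff_theta_zPi (hZ : ∀ i, Z i ∈ M.part (p i)) (s t : CostandardTableau lam mu p) :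
    tableauCoeff hZ s ((thetaConj lam mu k).app M (zPi Z hZ t.1 t.2.1)) =
      orbitCoeff Z (colBlock lam mu) (word s.1 ∘ sigmaConj lam mu)
        (superAct M (sigmaConj lam mu) (divPow Z (rowBlock lam mu) (word t.1))) := by
  rw [← zPi_val hZ t.2.1]
  rfl

theorem tableauCoeff_theta_zPi_self_ne_zero (hZ : ∀ i, Z i ∈ M.part (p i))
    (t : CostandardTableau lam mu p) :
    tableauCoeff hZ t ((thetaConj lam mu k).app M (zPi Z hZ t.1 t.2.1)) ≠ 0 := by
  rw [tableauCoeff_theta_zPi, orbitCoeff_eq_coeff hZ t.2.2.repeatsIn fun τ hτ h =>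
    word_comp_eq_of_coeff_ne_zero hZ t.2.1 hτ h rfl, coeff_superAct_ne_zero_iff hZ,
    coeff_divPow_self hZ t.2.1.repeatsIn]
  exact one_ne_zero

theorem column_weight_lt_of_tableauCoeff_ne_zero (hZ : ∀ i, Z i ∈ M.part (p i))
    {s t : CostandardTableau lam mu p} (hst : s ≠ t)
    (h : tableauCoeff hZ s ((thetaConj lam mu k).app M (zPi Z hZ t.1 t.2.1)) ≠ 0) :
    weight (colBlock lam mu) (word s.1 ∘ sigmaConj lam mu) <
      weight (colBlock lam mu) (word t.1 ∘ sigmaConj lam mu) := by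
  rw [tableauCoeff_theta_zPi] at h
  obtain ⟨τ, hτ, hcoeff⟩ := exists_coeff_ne_zero_of_orbitCoeff_ne_zero hZ h
  refine (column_weight_le_of_coeff_ne_zero hZ t.2.1 hτ hcoeff).lt_of_ne fun heq => hst ?_
  exact Subtype.ext (s.2.2.eq_of_word_comp_eq t.2.2 hτ
    (word_comp_eq_of_coeff_ne_zero hZ t.2.1 hτ hcoeff heq))

theorem linearIndependent_theta_zPi (hZ : ∀ i, Z i ∈ M.part (p i)) :
    LinearIndependent k fun t : CostandardTableau lam mu p =>
      (thetaConj lam mu k).app M (zPi Z hZ t.1 t.2.1) :=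
  linearIndependent_of_triangular (tableauCoeff hZ)
    (fun t => weight (colBlock lam mu) (word t.1 ∘ sigmaConj lam mu))
    (tableauCoeff_theta_zPi_self_ne_zero hZ)
    fun _ _ hst h => column_weight_lt_of_tableauCoeff_ne_zero hZ hst h

end Triangularity

/-! ### The isomorphism -/

section FirstIsomorphism

variable {k : Type u} [Field k] {d : ℕ} {F G : PolI k d}

theorem EvenIso.symm (h : EvenIso F G) : EvenIso G F := by
  obtain ⟨η, ζ, hζη, hηζ⟩ := h
  exact ⟨ζ, η, hηζ, hζη⟩

theorem isHomog_zero_symm {M N : SVec k} {e : M ≃ₗ[k] N} (he : IsHomog 0 e.toLinearMap) :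
    IsHomog 0 e.symm.toLinearMap := by
  intro δ y hy
  have hproj : M.proj δ (e.symm y) = e.symm y := e.injective <| by
    rw [e.apply_symm_apply]
    exact ((he.proj_comm δ (e.symm y)).trans (congrArg (N.proj δ) (e.apply_symm_apply y))).trans
      (N.proj_of_mem hy)
  rw [zero_add, LinearEquiv.coe_coe, ← hproj]
  exact M.proj_mem δ _

theorem EvenTrans.evenIso_of_bijective (η : EvenTrans F G)
    (h : ∀ M, Function.Bijective (η.app M)) : EvenIso F G := by
  let e : ∀ M, F.obj M ≃ₗ[k] G.obj M := fun M => LinearEquiv.ofBijective (η.app M) (h M)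
  refine ⟨η, ⟨fun M => (e M).symm, fun M => isHomog_zero_symm (e := e M) (η.even M), ?_⟩,
    fun M x => (e M).symm_apply_apply x, fun M y => (e M).apply_symm_apply y⟩
  intro M N φ y
  obtain ⟨x, rfl⟩ := (e M).surjective y
  refine (e N).injective (((e N).apply_symm_apply _).trans ?_)
  rw [LinearEquiv.coe_coe, (e M).symm_apply_apply]
  exact (η.natural φ x).symm

/-- The transformation `F/U → G` induced by `η : F → G` when `η` vanishes on `U`. -/
def EvenTrans.quotientLift (η : EvenTrans F G) (U : SubPol F)
    (hU : ∀ M, U.sub M ≤ LinearMap.ker (η.app M)) : EvenTrans U.quotient G where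
  app M := (U.sub M).liftQ (η.app M) (hU M)
  even M δ := by
    rintro _ ⟨x, hx, rfl⟩
    exact η.even M δ x hx
  natural φ y := by
    obtain ⟨x, rfl⟩ := Submodule.Quotient.mk_surjective _ y
    exact η.natural φ x

theorem EvenTrans.evenIso_image_quotient (η : EvenTrans F G) (U : SubPol F)
    (hU : ∀ M, U.sub M = LinearMap.ker (η.app M)) : EvenIso η.image.toPol U.quotient := by
  have hker : ∀ M, LinearMap.ker (η.toImage.app M) = U.sub M := fun M =>
    (LinearMap.ker_rangeRestrict _).trans (hU M).symm
  have hle : ∀ M, U.sub M ≤ LinearMap.ker (η.toImage.app M) := fun M => (hker M).ge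
  refine ((η.toImage.quotientLift U hle).evenIso_of_bijective fun M => ⟨?_, ?_⟩).symm
  · exact LinearMap.ker_eq_bot.1 (Submodule.ker_liftQ_eq_bot _ _ _ (hker M).le)
  · exact LinearMap.range_eq_top.1 ((Submodule.range_liftQ _ _ _).trans
      (LinearMap.range_rangeRestrict _))

end FirstIsomorphism

section Kernel

variable {k : Type u} [Field k] {N : ℕ} {lam mu : YoungDiagram} {M : SVec k}

theorem exists_homogeneous_basis (M : SVec k) :
    ∃ (N : ℕ) (Z : Module.Basis (Fin N) k M) (p : Fin N → ZMod 2), ∀ i, Z i ∈ M.part (p i) := by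
  let B := ((Module.finBasis k (M.part 0)).prod (Module.finBasis k (M.part 1))).map
    (Submodule.prodEquivOfIsCompl _ _ M.isCompl)
  refine ⟨_, B.reindex finSumFinEquiv, fun i => Sum.elim (fun _ => 0) (fun _ => 1)
    (finSumFinEquiv.symm i), fun i => ?_⟩
  obtain ⟨j, rfl⟩ := finSumFinEquiv.surjective i
  rcases j with j | j <;> simp [B]

theorem imDiamond_eq_ker_thetaConj (hk : ringChar k ≠ 2) (M : SVec k) :
    (imDiamond lam mu k).sub M = LinearMap.ker ((thetaConj lam mu k).app M) := by
  obtain ⟨N, Z, p, hZ⟩ := exists_homogeneous_basis M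
  have hdisj := Submodule.range_ker_disjoint
    (linearIndependent_theta_zPi (lam := lam) (mu := mu) hZ)
  refine eq_of_le_of_inf_le_of_sup_le (imDiamond_le_ker_thetaConj hk M)
    (hdisj.symm.eq_bot.trans_le bot_le) ?_
  rw [sup_comm ((imDiamond lam mu k).sub M), span_costandard_sup_imDiamond hk hZ]
  exact le_top

theorem span_theta_zPi_eq_top (hk : ringChar k ≠ 2) {Z : Module.Basis (Fin N) k M}
    {p : Fin N → ZMod 2} (hZ : ∀ i, Z i ∈ M.part (p i)) :
    Submodule.span k (Set.range fun t : CostandardTableau lam mu p =>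
      (thetaConj lam mu k).toImage.app M (zPi Z hZ t.1 t.2.1)) =
        (⊤ : Submodule k ((schurConj lam mu k).obj M)) := by
  have hker : ((imDiamond lam mu k).sub M).map ((thetaConj lam mu k).toImage.app M) = ⊥ :=
    LinearMap.le_ker_iff_map.1
      ((imDiamond_le_ker_thetaConj hk M).trans (LinearMap.ker_rangeRestrict _).ge)
  have hspan := congrArg (Submodule.map ((thetaConj lam mu k).toImage.app M))
    (span_costandard_sup_imDiamond (lam := lam) (mu := mu) hk hZ)
  rw [Submodule.map_sup, hker, sup_bot_eq, Submodule.map_span, ← Set.range_comp,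
    Submodule.map_top] at hspan
  exact hspan.trans (LinearMap.range_rangeRestrict _)

end Kernel

end SchurSuper

end

open SchurSuper in
theorem theorem3 {k : Type u} [Field k] (hk : ringChar k ≠ 2)
    (lam mu : YoungDiagram) (hmu : mu ≤ lam) :
    (∀ (M : SVec k) (m n : ℕ), M.HasSDim m n →
      ∀ (Z : Module.Basis (Fin (m + n)) k M) (p : Fin (m + n) → ZMod 2)
        (hZ : ∀ i, Z i ∈ M.part (p i)),
        LinearIndependent k (fun t : CostandardTableau lam mu p =>
          (thetaConj lam mu k).toImage.app M (zPi Z hZ t.1 t.2.1)) ∧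
        Submodule.span k (Set.range (fun t : CostandardTableau lam mu p =>
          (thetaConj lam mu k).toImage.app M (zPi Z hZ t.1 t.2.1))) =
            (⊤ : Submodule k ((schurConj lam mu k).obj M))) ∧
    EvenIso (schurConj lam mu k) (imDiamond lam mu k).quotient := by
  refine ⟨fun M m n _ Z p hZ => ⟨?_, span_theta_zPi_eq_top hk hZ⟩,
    (thetaConj lam mu k).evenIso_image_quotient _ (imDiamond_eq_ker_thetaConj hk)⟩
  exact LinearIndependent.of_comp (LinearMap.range ((thetaConj lam mu k).app M)).subtype
    (linearIndependent_theta_zPi hZ)
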